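/- Let $k$ be a field and $n\ge 2$. An $(n,n)$-Brauer diagram is a partition of $n$ lower and $n$ upper dots into pairs (lines); lines between two lower dots are called caps, lines between two upper dots cups, the other lines propagating. The periplectic Brauer algebra $A_n$ is the associative unital $k$-algebra spanned by the $(n,n)$-Brauer diagrams, with unit the diagram of $n$ vertical lines and the following product. Stack $d_1$ on top of $d_2$. If the stack contains a closed loop, then $d_1d_2=0$; otherwise $d_1d_2=(-1)^{\gamma}d$, where $d$ is the diagram given by the stack and $\gamma$ is found as follows. Mark each cup of $d_1$, $d_2$ with a diamond and each cap with an arrow pointing to the right, each marking at its own height; within one diagram all cups are higher than all caps, cups with left-most dot further to the left are higher, and caps with left-most dot further to the right are higher (the standard marking); all markings of $d_1$ are higher than those of $d_2$. Bring the decoration to the standard marking of $d$ by exchanging the heights of two markings of adjacent heights (one sign), reversing an arrow (one sign), and cancelling an arrow with a diamond that is at the next lower height and is the next marking on the same curve (no sign if the arrow points to the diamond, one sign if it points away). Then $\gamma$ is the number of signs; its parity does not depend on the choices. The symmetric group $S_n$ embeds in $A_n$ as the diagrams without cups and caps. Let $I\subset A_n$ be the two-sided ideal spanned by the diagrams with at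 least one cup (equivalently, cap). For $j<i$ let $(j,i)\in S_n$ be the transposition and $\overline{(j,i)}$ the diagram with one cup and one cap, each joining the dots $i$ and $j$, and vertical lines elsewhere. Put $$x_1=0,\qquad x_i=\sum_{j=1}^{i-1}\bigl((j,i)+\overline{(j,i)}\bigr)\quad(2\le i\le n).$$ The elements $x_1,\dots,x_n$ commute pairwise, so polynomials can be evaluated at them. Put $$\Theta=\prod_{2\le i<j\le n}\bigl(1-(x_i-x_j)^2\bigr)\ \text{ if } n>2,\qquad \Theta=0\ \text{ if } n=2,$$ and let $k[\underline x]^{S_{n-1}}\subset A_n$ be the set of all values $f(x_2,\dots,x_n)$ of symmetric polynomials $f$ in $n-1$ variables over $k$. **Theorem.** Let $f=f(x_2,\dots,x_n)$ with $f$ a symmetric polynomial in $n-1$ variables. Then $$w\,f\Theta=f\Theta\,w\ \text{ for all } w\in S_n,\qquad a\,f\Theta=0=f\Theta\,a\ \text{ for all } a\in I,$$ and $f\Theta$ belongs to the centre of $A_n$. Consequently the sum $k1+\Theta\,k[\underline x]^{S_{n-1}}$ is direct, and $k1\oplus\Theta\,k[\underline x]^{S_{n-1}}$ is a subalgebra of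 $A_n$ that is contained in the centre of $A_n$. -/

import Mathlib

/-- An `(n,n)`-Brauer diagram: a partition of `n` lower dots `Sum.inl i` and `n` upper dots
`Sum.inr i` into pairs, given by the fixed-point-free involution sending a dot to its partner. -/
@[ext]
structure BrauerDiagram (n : ℕ) where
  partner : Fin n ⊕ Fin n → Fin n ⊕ Fin n
  partner_partner : ∀ x, partner (partner x) = x
  partner_ne : ∀ x, partner x ≠ x

namespace BrauerDiagram

variable {n : ℕ}

/-- The diagram of a permutation `w`: the lower dot `i` is joined to the upper dot `w i`. -/
def ofPerm (w : Equiv.Perm (Fin n)) : BrauerDiagram n where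
  partner x := match x with
    | .inl i => .inr (w i)
    | .inr i => .inl (w.symm i)
  partner_partner x := by rcases x with i | i <;> simp
  partner_ne x := by rcases x with i | i <;> simp

/-- The diagram `overline (j,i)`: a cap joining the lower dots `i` and `j`, a cup joining the upper
dots `i` and `j`, and vertical lines elsewhere. -/
def bar (j i : Fin n) (h : j ≠ i) : BrauerDiagram n where
  partner x := match x with
    | .inl l => if l = i then .inl j else if l = j then .inl i else .inr l
    | .inr l => if l = i then .inr j else if l = j then .inr i else .inl l
  partner_partner x := by rcases x with l | l <;> grind
  partner_ne x := by rcases x with l | l <;> grind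

/-- Some line joins two lower dots. -/
def HasCap (d : BrauerDiagram n) : Prop := ∃ i j, d.partner (.inl i) = .inl j

/-- Some line joins two upper dots. -/
def HasCup (d : BrauerDiagram n) : Prop := ∃ i j, d.partner (.inr i) = .inr j

end BrauerDiagram

/-- The dots of a stack of two diagrams: lower dots, identified middle dots, upper dots. -/
inductive StackDot (n : ℕ) where
  | bot (i : Fin n)
  | mid (i : Fin n)
  | top (i : Fin n)
  deriving DecidableEq

namespace StackDot

variable {n : ℕ}

/-- The dots of the diagram drawn on top, inside the stack. -/
def upper : Fin n ⊕ Fin n → StackDot n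
  | .inl i => mid i
  | .inr i => top i

/-- The dots of the diagram drawn below, inside the stack. -/
def lower : Fin n ⊕ Fin n → StackDot n
  | .inl i => bot i
  | .inr i => mid i

/-- The outer dots of the stack. -/
def outer : Fin n ⊕ Fin n → StackDot n
  | .inl i => bot i
  | .inr i => top i

end StackDot

namespace BrauerDiagram

variable {n : ℕ}

/-- Two dots of the stack "`d₁` on top of `d₂`" are joined by a line of `d₁` or of `d₂`. -/
inductive Joined (d₁ d₂ : BrauerDiagram n) : StackDot n → StackDot n → Prop
  | upper (x : Fin n ⊕ Fin n) : Joined d₁ d₂ (.upper x) (.upper (d₁.partner x))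
  | lower (x : Fin n ⊕ Fin n) : Joined d₁ d₂ (.lower x) (.lower (d₂.partner x))

/-- Two dots of the stack lie on the same curve. -/
def Connected (d₁ d₂ : BrauerDiagram n) : StackDot n → StackDot n → Prop :=
  Relation.EqvGen (Joined d₁ d₂)

/-- The stack contains a closed loop, that is, a curve that meets no outer dot. -/
def HasLoop (d₁ d₂ : BrauerDiagram n) : Prop :=
  ∃ i, ∀ x, ¬ Connected d₁ d₂ (.mid i) (.outer x)

/-- `d` is the Brauer diagram given by the stack of `d₁` on top of `d₂`: two different outer dots
are joined in `d` exactly if they lie on the same curve of the stack. -/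
def IsStack (d₁ d₂ d : BrauerDiagram n) : Prop :=
  ∀ x y, d.partner x = y ↔ x ≠ y ∧ Connected d₁ d₂ (.outer x) (.outer y)

end BrauerDiagram

/-- A marking of a curve. `cup a b` is a diamond, and `cap a b` is an arrow pointing from `a` towards
`b`; here `a` and `b` name the two ends of the unmarked pieces of curve on the two sides of the
marking. -/
inductive Marking (P : Type*) where
  | cup (a b : P)
  | cap (a b : P)

namespace Marking

variable {P Q : Type*}

def map (f : P → Q) : Marking P → Marking Q
  | cup a b => cup (f a) (f b)
  | cap a b => cap (f a) (f b)

end Marking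

/-- The moves on decorations. A decoration is the list of its markings, from the highest line of
latitude to the lowest one. `Moves l γ l'` says that `l` can be turned into `l'` by moves with `γ` of
them contributing a sign:
* `swap`: permuting two adjacent lines of latitude (one sign);
* `cup_symm`: the two ends of a diamond are interchangeable (no sign);
* `cap_rev`: reversing an arrow (one sign, caps are skew symmetric);
* `cancel_left`, `cancel_right`: cancelling an arrow with a diamond directly below it which is the
  next marking on the same curve; there is no sign if the arrow points to the diamond (and one sign
  if it points away, by `cap_rev`). Afterwards the ends `a` and `c` bound one unmarked piece of curve,
  which is then named by either of them. -/
inductive Moves {P : Type*} [DecidableEq P] : List (Marking P) → ℕ → List (Marking P) → Prop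
  | refl (l) : Moves l 0 l
  | trans {l₁ l₂ l₃ γ γ'} : Moves l₁ γ l₂ → Moves l₂ γ' l₃ → Moves l₁ (γ + γ') l₃
  | swap (u v x y) : Moves (u ++ x :: y :: v) 1 (u ++ y :: x :: v)
  | cup_symm (u v a b) : Moves (u ++ .cup a b :: v) 0 (u ++ .cup b a :: v)
  | cap_rev (u v a b) : Moves (u ++ .cap a b :: v) 1 (u ++ .cap b a :: v)
  | cancel_left (u v a b c) : Moves (u ++ .cap a b :: .cup b c :: v) 0
      ((u ++ v).map (Marking.map fun x => if x = c then a else x))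
  | cancel_right (u v a b c) : Moves (u ++ .cap a b :: .cup b c :: v) 0
      ((u ++ v).map (Marking.map fun x => if x = a then c else x))

namespace BrauerDiagram

variable {n : ℕ}

/-- The standard marking: all cups are above all caps, a cup is higher if its left-most dot is
further to the left, a cap is higher if its left-most dot is further to the right, and all arrows
point to the right. -/
def standardMarking (d : BrauerDiagram n) : List (Marking (Fin n ⊕ Fin n)) :=
  (List.finRange n).filterMap (fun i => match d.partner (.inr i) with
    | .inr j => if i < j then some (.cup (.inr i) (.inr j)) else none
    | .inl _ => none) ++
  (List.finRange n).reverse.filterMap (fun i => match d.partner (.inl i) with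
    | .inl j => if i < j then some (.cap (.inl i) (.inl j)) else none
    | .inr _ => none)

/-- The end, in the stack, of the unmarked piece of curve of the stack of `d₁` on top of `d₂` that
starts from a marking of `d₁` through the dot `x` of `d₁`: if `x` is a lower dot of `d₁`, and if the
line of `d₂` below it is propagating, this piece continues down to a lower dot of `d₂`. -/
def upperEnd (d₂ : BrauerDiagram n) : Fin n ⊕ Fin n → StackDot n
  | .inr i => .top i
  | .inl i => match d₂.partner (.inr i) with
    | .inl j => .bot j
    | .inr _ => .mid i

/-- The same for a marking of `d₂` and a dot `x` of `d₂`. -/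
def lowerEnd (d₁ : BrauerDiagram n) : Fin n ⊕ Fin n → StackDot n
  | .inl i => .bot i
  | .inr i => match d₁.partner (.inl i) with
    | .inr j => .top j
    | .inl _ => .mid i

/-- The decoration of the stack of `d₁` on top of `d₂` obtained from the standard markings. -/
def stackMarking (d₁ d₂ : BrauerDiagram n) : List (Marking (StackDot n)) :=
  d₁.standardMarking.map (Marking.map (upperEnd d₂)) ++
  d₂.standardMarking.map (Marking.map (lowerEnd d₁))

/-- The stack of `d₁` on top of `d₂` has no loop, it gives the diagram `d`, and its decoration can be
turned into the standard marking of `d` with `γ` signs. -/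
def Composes (d₁ d₂ : BrauerDiagram n) (γ : ℕ) (d : BrauerDiagram n) : Prop :=
  ¬ HasLoop d₁ d₂ ∧ IsStack d₁ d₂ d ∧
    Moves (stackMarking d₁ d₂) γ (d.standardMarking.map (Marking.map StackDot.outer))

end BrauerDiagram

namespace PeriplecticBrauer

open BrauerDiagram

/-- The multiplication rule of Brauer diagrams: the diagram with `n` vertical lines is the unit, and
`d₁ d₂` is zero if the stack of `d₁` on top of `d₂` has a loop, and `(-1)^γ` times the diagram given
by the stack otherwise. -/
inductive Rel (k : Type*) [Field k] (n : ℕ) :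
    FreeAlgebra k (BrauerDiagram n) → FreeAlgebra k (BrauerDiagram n) → Prop
  | one : Rel k n (FreeAlgebra.ι k (ofPerm 1)) 1
  | loop (d₁ d₂ : BrauerDiagram n) : HasLoop d₁ d₂ →
      Rel k n (FreeAlgebra.ι k d₁ * FreeAlgebra.ι k d₂) 0
  | comp (d₁ d₂ d : BrauerDiagram n) (γ : ℕ) : Composes d₁ d₂ γ d →
      Rel k n (FreeAlgebra.ι k d₁ * FreeAlgebra.ι k d₂) ((-1 : k) ^ γ • FreeAlgebra.ι k d)

end PeriplecticBrauer

/-- The periplectic Brauer algebra `A_n`: the associative unital `k`-algebra spanned by the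
`(n,n)`-Brauer diagrams, with the multiplication rule of diagrams. (The parity of `γ` does not depend
on the moves and the rule is associative, so the diagrams are a basis.) -/
abbrev PeriplecticBrauer (k : Type*) [Field k] (n : ℕ) : Type _ :=
  RingQuot (PeriplecticBrauer.Rel k n)

namespace PeriplecticBrauer

open BrauerDiagram

variable (k : Type*) [Field k] {n : ℕ}

/-- A Brauer diagram as an element of `A_n`. -/
noncomputable def ofDiagram (d : BrauerDiagram n) : PeriplecticBrauer k n :=
  RingQuot.mkAlgHom k (Rel k n) (FreeAlgebra.ι k d)

variable (n) in
/-- The span `I` of the diagrams with at least one cup or cap. -/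
noncomputable def capIdeal : Submodule k (PeriplecticBrauer k n) :=
  Submodule.span k {a | ∃ d : BrauerDiagram n, (d.HasCup ∨ d.HasCap) ∧ a = ofDiagram k d}

/-- The Jucys–Murphy elements `∑_{j < i} ((j,i) + overline (j,i))`. Indices start from `0`, so that
`jm k i` is usually written `x_{i+1}`. -/
noncomputable def jm (i : Fin n) : PeriplecticBrauer k n :=
  ∑ j : {j : Fin n // j < i},
    (ofDiagram k (ofPerm (Equiv.swap j.1 i)) + ofDiagram k (bar j.1 i j.2.ne))

/-- The positions `2, …, n` (here `1, …, n - 1`, as indices start from `0`). -/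
abbrev Pos (n : ℕ) : Type := {i : Fin n // 0 < (i : ℕ)}

/-- The value of a polynomial at the Jucys–Murphy elements `x_2, …, x_n`; the factors of a monomial
are multiplied in increasing order of the index. -/
noncomputable def evalJM (f : MvPolynomial (Pos n) k) : PeriplecticBrauer k n :=
  ∑ m ∈ f.support, f.coeff m •
    (((Finset.univ : Finset (Pos n)).sort (· ≤ ·)).map fun i => jm k i.1 ^ m i).prod

variable (n) in
/-- `Θ = ∏_{2 ≤ i < j ≤ n} (1 - (x_i - x_j)²)` if `n ≠ 2`, and `Θ = 0` if `n = 2`. -/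
noncomputable def theta : PeriplecticBrauer k n :=
  if n = 2 then 0 else
    ((((Finset.univ : Finset (Pos n)).sort (· ≤ ·) ×ˢ
        (Finset.univ : Finset (Pos n)).sort (· ≤ ·)).filter fun p => p.1 < p.2).map
      fun p => 1 - (jm k p.1.1 - jm k p.2.1) ^ 2).prod

variable (n) in
/-- `Θ k[x_2, …, x_n]^{S_{n-1}}`, spanned by the `Θ f(x_2, …, x_n)` with `f` symmetric. -/
noncomputable def thetaSymm : Submodule k (PeriplecticBrauer k n) :=
  Submodule.span k
    {a | ∃ f : MvPolynomial (Pos n) k, f.IsSymmetric ∧ a = theta k n * evalJM k f}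

end PeriplecticBrauer

/-! Everything follows from a few relations between permutations and arcs, where the arc of `a` and
`b` is `bar a b` made skew symmetric in `a` and `b`. They hold for every map compatible with the
multiplication rule (`DiagramRep`), so neither linear independence of the diagrams nor
well-definedness of the sign is needed.

Let `q = p + 1`, let `s` be the transposition of `p` and `q`, and let `e` be their arc. Then `s x_p
= x_q s - 1 + e`, `e (x_p - x_q) = e` and `(x_p - x_q) e = -e`. Hence the factor `1 - (x_p - x_q)²`
of `Θ` is killed by `e` on both sides. In its presence the terms with `e` disappear, and `s` moves
past a polynomial as in the degenerate affine Hecke algebra, the correction being a divided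
difference (`transposition_mul_ev`). Since `Θ` is symmetric, `f Θ` is this factor times a polynomial
invariant under exchanging its two variables. The divided difference is then zero, so `f Θ` commutes
with `s` and is killed by `e`.

No factor contains `x_1`, so the first pair of dots needs another argument: its arc is killed by `1
- (x_2 - x_3)²`, and its transposition is `x_2` minus that arc. This is where `n > 2` enters.

Adjacent transpositions generate `S_n`, conjugation reaches all arcs, and a diagram with a cap is,
up to sign, a diagram with fewer caps times an arc; so `f Θ` is central and annihilates `I`. The sum
is direct because the character that is 1 on permutations and 0 on diagrams with caps kills `Θ`. -/

namespace StackDot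

variable {n : ℕ}

/-! ### Stacks, curves and moves -/

@[simp] theorem upper_inl (i : Fin n) : upper (.inl i) = mid i := rfl
@[simp] theorem upper_inr (i : Fin n) : upper (.inr i) = top i := rfl
@[simp] theorem lower_inl (i : Fin n) : lower (.inl i) = bot i := rfl
@[simp] theorem lower_inr (i : Fin n) : lower (.inr i) = mid i := rfl
@[simp] theorem outer_inl (i : Fin n) : outer (.inl i) = bot i := rfl
@[simp] theorem outer_inr (i : Fin n) : outer (.inr i) = top i := rfl

/-- The map of the dots of a stack to the outer dots that fixes the outer dots and is given by `r` on
the middle dots. -/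
def retract (r : Fin n → Fin n ⊕ Fin n) : StackDot n → Fin n ⊕ Fin n
  | bot i => .inl i
  | mid i => r i
  | top i => .inr i

@[simp] theorem retract_outer (r : Fin n → Fin n ⊕ Fin n) (x : Fin n ⊕ Fin n) :
    retract r (outer x) = x := by
  cases x <;> rfl

end StackDot

/-- Lists that are permutations of each other are connected by moves. -/
theorem Moves.exists_of_perm {P : Type*} [DecidableEq P] {l l' : List (Marking P)}
    (h : l.Perm l') : ∃ γ, Moves l γ l' := by
  suffices H : ∀ u, ∃ γ, Moves (u ++ l) γ (u ++ l') by simpa using H []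
  induction h with
  | nil => exact fun u => ⟨0, .refl _⟩
  | cons x _ ih => exact fun u => by simpa using ih (u ++ [x])
  | swap x y l => exact fun u => ⟨1, .swap u l y x⟩
  | trans _ _ ih₁ ih₂ =>
    intro u
    obtain ⟨γ, h⟩ := ih₁ u
    obtain ⟨γ', h'⟩ := ih₂ u
    exact ⟨_, h.trans h'⟩

/-- Every elementary move needs a marking to act on. This pins down the sign in a product of two
permutations, as the character requires. -/
theorem Moves.eq_zero_of_nil {P : Type*} [DecidableEq P] {l l' : List (Marking P)} {γ : ℕ}
    (h : Moves l γ l') (hl : l = []) : γ = 0 ∧ l' = [] := by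
  induction h with
  | refl => exact ⟨rfl, hl⟩
  | trans _ _ ih₁ ih₂ =>
    obtain ⟨rfl, h⟩ := ih₁ hl
    obtain ⟨rfl, h'⟩ := ih₂ h
    exact ⟨rfl, h'⟩
  | _ => simp at hl

namespace BrauerDiagram

variable {n : ℕ}

/-- Replace the lines through the dots `x` and `y` by a line from `x` to `y` and a line joining the
former partners of `x` and `y`. -/
def reconnect (d : BrauerDiagram n) (x y : Fin n ⊕ Fin n) (hxy : x ≠ y) (h : d.partner x ≠ y) :
    BrauerDiagram n where
  partner z := if z = x then y else if z = y then x else if z = d.partner x then d.partner y else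
    if z = d.partner y then d.partner x else d.partner z
  partner_partner z := by
    have := d.partner_partner; have := d.partner_ne; grind
  partner_ne z := by
    have := d.partner_partner; have := d.partner_ne; grind

theorem partner_eq_iff (d : BrauerDiagram n) {x y : Fin n ⊕ Fin n} :
    d.partner x = y ↔ x = d.partner y := by
  have := d.partner_partner; grind

theorem Connected.symm {d₁ d₂ : BrauerDiagram n} {x y : StackDot n}
    (h : Connected d₁ d₂ x y) : Connected d₁ d₂ y x :=
  Relation.EqvGen.symm _ _ h

theorem Connected.trans {d₁ d₂ : BrauerDiagram n} {x y z : StackDot n}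
    (h : Connected d₁ d₂ x y) (h' : Connected d₁ d₂ y z) : Connected d₁ d₂ x z :=
  Relation.EqvGen.trans _ _ _ h h'

theorem connected_refl (d₁ d₂ : BrauerDiagram n) (x : StackDot n) : Connected d₁ d₂ x x :=
  Relation.EqvGen.refl _

theorem connected_upper (d₁ d₂ : BrauerDiagram n) {x y : Fin n ⊕ Fin n}
    (h : d₁.partner x = y) : Connected d₁ d₂ (.upper x) (.upper y) :=
  h ▸ .rel _ _ (.upper x)

theorem connected_lower (d₁ d₂ : BrauerDiagram n) {x y : Fin n ⊕ Fin n}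
    (h : d₂.partner x = y) : Connected d₁ d₂ (.lower x) (.lower y) :=
  h ▸ .rel _ _ (.lower x)

theorem not_hasLoop_of_retract {d₁ d₂ : BrauerDiagram n} (r : Fin n → Fin n ⊕ Fin n)
    (hr : ∀ i, Connected d₁ d₂ (.mid i) (.outer (r i))) : ¬ HasLoop d₁ d₂ :=
  fun ⟨i, h⟩ => h _ (hr i)

/-- Being equal or partners in `d` is an equivalence relation on outer dots, because `d.partner` is
an involution. It therefore suffices that the retraction respects it on the single lines of the
stack, which are the generators of `Connected`. -/
theorem isStack_of_retract {d₁ d₂ d : BrauerDiagram n} (r : Fin n → Fin n ⊕ Fin n)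
    (hd : ∀ x, Connected d₁ d₂ (.outer x) (.outer (d.partner x)))
    (h₁ : ∀ x, Sum.elim r .inr (d₁.partner x) = Sum.elim r .inr x ∨
      Sum.elim r .inr (d₁.partner x) = d.partner (Sum.elim r .inr x))
    (h₂ : ∀ x, Sum.elim .inl r (d₂.partner x) = Sum.elim .inl r x ∨
      Sum.elim .inl r (d₂.partner x) = d.partner (Sum.elim .inl r x)) :
    IsStack d₁ d₂ d := by
  have hu : ∀ x : Fin n ⊕ Fin n, StackDot.retract r (.upper x) = Sum.elim r .inr x := by
    rintro (i | i) <;> rfl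
  have hl : ∀ x : Fin n ⊕ Fin n, StackDot.retract r (.lower x) = Sum.elim .inl r x := by
    rintro (i | i) <;> rfl
  have key : ∀ x y, Connected d₁ d₂ x y → StackDot.retract r y = StackDot.retract r x ∨
      StackDot.retract r y = d.partner (StackDot.retract r x) := by
    intro x y h
    induction h with
    | rel x y h =>
      cases h with
      | upper x => simpa only [hu] using h₁ x
      | lower x => simpa only [hl] using h₂ x
    | refl => exact .inl rfl
    | symm x y _ ih => have := d.partner_partner; grind
    | trans x y z _ _ ih ih' => have := d.partner_partner; grind
  intro x y
  constructor
  · rintro rfl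
    exact ⟨(d.partner_ne x).symm, hd x⟩
  · rintro ⟨hne, h⟩
    have := key _ _ h
    simp only [StackDot.retract_outer] at this
    grind

theorem IsStack.unique {d₁ d₂ d d' : BrauerDiagram n} (h : IsStack d₁ d₂ d)
    (h' : IsStack d₁ d₂ d') : d = d' := by
  ext1
  funext x
  exact (h x _).2 ((h' x _).1 rfl)

/-! ### Standard markings -/

/-- The cups in the standard marking. -/
def cupMarking (d : BrauerDiagram n) : List (Marking (Fin n ⊕ Fin n)) :=
  (List.finRange n).filterMap (fun i => match d.partner (.inr i) with
    | .inr j => if i < j then some (.cup (.inr i) (.inr j)) else none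
    | .inl _ => none)

/-- The caps in the standard marking. -/
def capMarking (d : BrauerDiagram n) : List (Marking (Fin n ⊕ Fin n)) :=
  (List.finRange n).reverse.filterMap (fun i => match d.partner (.inl i) with
    | .inl j => if i < j then some (.cap (.inl i) (.inl j)) else none
    | .inr _ => none)

theorem standardMarking_eq (d : BrauerDiagram n) :
    d.standardMarking = d.cupMarking ++ d.capMarking := rfl

theorem mem_cupMarking {d : BrauerDiagram n} {m : Marking (Fin n ⊕ Fin n)} :
    m ∈ d.cupMarking ↔
      ∃ i j, i < j ∧ d.partner (.inr i) = .inr j ∧ m = .cup (.inr i) (.inr j) := by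
  simp only [cupMarking, List.mem_filterMap, List.mem_finRange, true_and]
  refine exists_congr fun i => ?_
  rcases d.partner (.inr i) with j | j
  · simp
  · simp only [Option.ite_none_right_eq_some, Option.some.injEq, Sum.inr.injEq]
    grind

theorem mem_capMarking {d : BrauerDiagram n} {m : Marking (Fin n ⊕ Fin n)} :
    m ∈ d.capMarking ↔
      ∃ i j, i < j ∧ d.partner (.inl i) = .inl j ∧ m = .cap (.inl i) (.inl j) := by
  simp only [capMarking, List.mem_filterMap, List.mem_reverse, List.mem_finRange, true_and]
  refine exists_congr fun i => ?_
  rcases d.partner (.inl i) with j | j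
  · simp only [Option.ite_none_right_eq_some, Option.some.injEq, Sum.inl.injEq]
    grind
  · simp

theorem nodup_cupMarking (d : BrauerDiagram n) : d.cupMarking.Nodup := by
  refine (List.nodup_finRange n).filterMap fun i i' m h h' => ?_
  rcases h₁ : d.partner (.inr i) with j | j <;> rcases h₂ : d.partner (.inr i') with j' | j' <;>
    simp only [h₁, h₂, Option.mem_def, reduceCtorEq, Option.ite_none_right_eq_some,
      Option.some.injEq] at h h'
  grind

theorem nodup_capMarking (d : BrauerDiagram n) : d.capMarking.Nodup := by
  refine (List.nodup_reverse.2 (List.nodup_finRange n)).filterMap fun i i' m h h' => ?_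
  rcases h₁ : d.partner (.inl i) with j | j <;> rcases h₂ : d.partner (.inl i') with j' | j' <;>
    simp only [h₁, h₂, Option.mem_def, reduceCtorEq, Option.ite_none_right_eq_some,
      Option.some.injEq] at h h'
  grind

/-- Without repetitions, two markings agree up to order as soon as they have the same members. -/
theorem nodup_standardMarking (d : BrauerDiagram n) : d.standardMarking.Nodup := by
  rw [standardMarking_eq, List.nodup_append]
  refine ⟨d.nodup_cupMarking, d.nodup_capMarking, fun m h m' h' => ?_⟩
  rw [mem_cupMarking] at h
  rw [mem_capMarking] at h'
  grind

theorem standardMarking_ofPerm (w : Equiv.Perm (Fin n)) : (ofPerm w).standardMarking = [] := by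
  simp [standardMarking, ofPerm]

theorem standardMarking_bar {a b : Fin n} (hab : a < b) :
    (bar a b hab.ne).standardMarking = [.cup (.inr a) (.inr b), .cap (.inl a) (.inl b)] := by
  have h₁ : (bar a b hab.ne).cupMarking = [.cup (.inr a) (.inr b)] := by
    refine List.perm_singleton.1 ((List.perm_ext_iff_of_nodup (nodup_cupMarking _)
      (List.nodup_singleton _)).2 fun m => ?_)
    simp only [mem_cupMarking, bar, List.mem_singleton]
    grind
  have h₂ : (bar a b hab.ne).capMarking = [.cap (.inl a) (.inl b)] := by
    refine List.perm_singleton.1 ((List.perm_ext_iff_of_nodup (nodup_capMarking _)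
      (List.nodup_singleton _)).2 fun m => ?_)
    simp only [mem_capMarking, bar, List.mem_singleton]
    grind
  rw [standardMarking_eq, h₁, h₂]; rfl

end BrauerDiagram

/-! ### Stacking a diagram with a single arc -/

namespace BrauerDiagram

variable {n : ℕ}

/-- The diagram in which two propagating lines, starting from the lower dots `a` and `b` of a
diagram, have been replaced by a cap and a cup. -/
abbrev bend (d : BrauerDiagram n) {a b p q : Fin n} (hab : a ≠ b) (ha : d.partner (.inl a) = .inr p)
    (_ : d.partner (.inl b) = .inr q) : BrauerDiagram n :=
  d.reconnect (.inl a) (.inl b) (by simpa using hab) (by simp [ha])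

section Bend

variable {d : BrauerDiagram n} {a b p q : Fin n} (hab : a ≠ b)
  (ha : d.partner (.inl a) = .inr p) (hb : d.partner (.inl b) = .inr q)

theorem ne_of_partner_ne {d : BrauerDiagram n} {a b p q : Fin n} (hab : a ≠ b)
    (ha : d.partner (.inl a) = .inr p) (hb : d.partner (.inl b) = .inr q) : p ≠ q := by
  rintro rfl
  have := d.partner_partner
  grind

theorem bar_comm (hab : a ≠ b) : bar a b hab = bar b a hab.symm := by
  ext1; funext x; simp only [bar]; grind

/-- The cap of `bar a b` survives as it is, its cup is prolonged along the two propagating lines to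
`p` and `q`, and all other lines are unchanged. -/
theorem connected_bend_bar : (∀ i, Connected d (bar a b hab) (.mid i)
      (.outer (if i = a then .inr p else if i = b then .inr q else .inl i))) ∧
    IsStack d (bar a b hab) (d.bend hab ha hb) := by
  have hpp := d.partner_partner
  have hne := d.partner_ne
  have hr : ∀ i, Connected d (bar a b hab) (.mid i)
      (.outer (if i = a then .inr p else if i = b then .inr q else .inl i)) := by
    intro i
    split_ifs with h h'
    · subst h; exact connected_upper _ _ ha
    · subst h'; exact connected_upper _ _ hb
    · exact connected_lower d _ (x := .inr i) (y := .inl i) (by simp [bar, h, h'])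
  refine ⟨hr, isStack_of_retract
    (fun i => if i = a then .inr p else if i = b then .inr q else .inl i) ?_ ?_ ?_⟩
  rotate_left
  · rintro (x | x) <;>
    rcases hx : d.partner _ with y | y <;>
    simp only [Sum.elim_inl, Sum.elim_inr, reconnect] <;> grind
  · rintro (x | x) <;> simp only [bar, reconnect] <;> grind
  have h₁ : ∀ x : Fin n ⊕ Fin n, x ≠ .inl a → x ≠ .inl b →
      Connected d (bar a b hab) (.outer x) (.upper x) := by
    rintro (x | x) h h'
    · exact connected_lower d _ (x := .inl x) (y := .inr x) (by simp [bar]; grind)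
    · exact connected_refl _ _ _
  have h₂ : Connected d (bar a b hab) (.bot a) (.bot b) :=
    connected_lower d _ (x := .inl a) (y := .inl b) (by simp [bar, hab])
  have h₃ : Connected d (bar a b hab) (.mid a) (.mid b) :=
    connected_lower d _ (x := .inr a) (y := .inr b) (by simp [bar, hab])
  have h₄ : Connected d (bar a b hab) (.top p) (.top q) :=
    ((connected_upper _ _ ha).symm.trans h₃).trans (connected_upper _ _ hb)
  intro x
  simp only [reconnect]
  split_ifs with c₁ c₂ c₃ c₄
  · rw [c₁]; exact h₂
  · rw [c₂]; exact h₂.symm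
  · rw [c₃, ha, hb]; exact h₄
  · rw [c₄, ha, hb]; exact h₄.symm
  · exact ((h₁ x c₁ c₂).trans (connected_upper _ _ rfl)).trans
      (h₁ _ (by grind) (by grind)).symm

theorem connected_bar_bend (hpq : p ≠ q) : (∀ i, Connected (bar p q hpq) d (.mid i)
      (.outer (if i = p then .inl a else if i = q then .inl b else .inr i))) ∧
    IsStack (bar p q hpq) d (d.bend hab ha hb) := by
  have hpp := d.partner_partner
  have hne := d.partner_ne
  have ha' : d.partner (.inr p) = .inl a := (partner_eq_iff _).2 ha.symm
  have hb' : d.partner (.inr q) = .inl b := (partner_eq_iff _).2 hb.symm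
  have hr : ∀ i, Connected (bar p q hpq) d (.mid i)
      (.outer (if i = p then .inl a else if i = q then .inl b else .inr i)) := by
    intro i
    split_ifs with h h'
    · subst h; exact connected_lower _ _ ha'
    · subst h'; exact connected_lower _ _ hb'
    · exact connected_upper _ d (x := .inl i) (y := .inr i) (by simp [bar, h, h'])
  refine ⟨hr, isStack_of_retract
    (fun i => if i = p then .inl a else if i = q then .inl b else .inr i) ?_ ?_ ?_⟩
  rotate_left
  · rintro (x | x) <;> simp only [bar, reconnect] <;> grind
  · rintro (x | x) <;>
    rcases hx : d.partner _ with y | y <;>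
    simp only [Sum.elim_inl, Sum.elim_inr, reconnect] <;> grind
  have h₁ : ∀ x : Fin n ⊕ Fin n, x ≠ .inr p → x ≠ .inr q →
      Connected (bar p q hpq) d (.outer x) (.lower x) := by
    rintro (x | x) h h'
    · exact connected_refl _ _ _
    · exact connected_upper _ d (x := .inr x) (y := .inl x) (by simp [bar]; grind)
  have h₂ : Connected (bar p q hpq) d (.top p) (.top q) :=
    connected_upper _ d (x := .inr p) (y := .inr q) (by simp [bar, hpq])
  have h₃ : Connected (bar p q hpq) d (.mid p) (.mid q) :=
    connected_upper _ d (x := .inl p) (y := .inl q) (by simp [bar, hpq])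
  have h₄ : Connected (bar p q hpq) d (.bot a) (.bot b) :=
    ((connected_lower _ _ ha').symm.trans h₃).trans (connected_lower _ _ hb')
  intro x
  simp only [reconnect]
  split_ifs with c₁ c₂ c₃ c₄
  · rw [c₁]; exact h₄
  · rw [c₂]; exact h₄.symm
  · rw [c₃, ha, hb]; exact h₂
  · rw [c₄, ha, hb]; exact h₂.symm
  · exact ((h₁ x (by grind) (by grind)).trans (connected_lower _ _ rfl)).trans
      (h₁ _ (by grind) (by grind)).symm

/-- The caps of `d` avoid `a` and `b`, so they continue straight down through vertical lines of `bar
a b`. -/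
theorem stackMarking_bend_bar (hab : a < b) (ha : d.partner (.inl a) = .inr p)
    (hb : d.partner (.inl b) = .inr q) :
    stackMarking d (bar a b hab.ne) = d.standardMarking.map (Marking.map StackDot.outer) ++
      [.cup (.top p) (.top q), .cap (.bot a) (.bot b)] := by
  have hpp := d.partner_partner
  unfold stackMarking
  congr 1
  · refine List.map_congr_left fun m hm => ?_
    rw [standardMarking_eq, List.mem_append, mem_cupMarking, mem_capMarking] at hm
    obtain ⟨i, j, -, -, rfl⟩ | ⟨i, j, -, h, rfl⟩ := hm
    · rfl
    · have hi : i ≠ a ∧ i ≠ b := by grind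
      have hj : j ≠ a ∧ j ≠ b := by grind
      simp [Marking.map, upperEnd, bar, hi, hj]
  · simp [standardMarking_bar hab, Marking.map, lowerEnd, ha, hb]

theorem stackMarking_bar_bend (hpq : p < q) (ha : d.partner (.inl a) = .inr p)
    (hb : d.partner (.inl b) = .inr q) :
    stackMarking (bar p q hpq.ne) d = [.cup (.top p) (.top q), .cap (.bot a) (.bot b)] ++
      d.standardMarking.map (Marking.map StackDot.outer) := by
  have hpp := d.partner_partner
  have ha' : d.partner (.inr p) = .inl a := (partner_eq_iff _).2 ha.symm
  have hb' : d.partner (.inr q) = .inl b := (partner_eq_iff _).2 hb.symm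
  unfold stackMarking
  congr 1
  · simp [standardMarking_bar hpq, Marking.map, upperEnd, ha', hb']
  · refine List.map_congr_left fun m hm => ?_
    rw [standardMarking_eq, List.mem_append, mem_cupMarking, mem_capMarking] at hm
    obtain ⟨i, j, -, h, rfl⟩ | ⟨i, j, -, -, rfl⟩ := hm
    · have hi : i ≠ p ∧ i ≠ q := by grind
      have hj : j ≠ p ∧ j ≠ q := by grind
      simp [Marking.map, lowerEnd, bar, hi, hj]
    · rfl

/-- The standard marking of `d.bend`, up to order. -/
theorem standardMarking_bend_perm (hab : a < b) (ha : d.partner (.inl a) = .inr p)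
    (hb : d.partner (.inl b) = .inr q) :
    (d.standardMarking ++
      ([.cup (.inr (min p q)) (.inr (max p q)), .cap (.inl a) (.inl b)] :
        List (Marking (Fin n ⊕ Fin n)))).Perm
      (d.bend hab.ne ha hb).standardMarking := by
  have hpp := d.partner_partner
  have hpq := ne_of_partner_ne hab.ne ha hb
  have ha' : d.partner (.inr p) = .inl a := (partner_eq_iff _).2 ha.symm
  have hb' : d.partner (.inr q) = .inl b := (partner_eq_iff _).2 hb.symm
  refine (List.perm_ext_iff_of_nodup ?_ (nodup_standardMarking _)).2 ?_
  · refine List.nodup_append.2 ⟨d.nodup_standardMarking, by simp, fun m hm m' hm' => ?_⟩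
    rw [standardMarking_eq, List.mem_append, mem_cupMarking, mem_capMarking] at hm
    grind
  · intro m
    simp only [standardMarking_eq, List.mem_append, mem_cupMarking, mem_capMarking, reconnect,
      List.mem_cons, List.not_mem_nil, or_false]
    rcases m with ⟨x, y⟩ | ⟨x, y⟩
    · have : ∀ i j, i < j → ((d.bend hab.ne ha hb).partner (.inr i) = .inr j ↔
          d.partner (.inr i) = .inr j ∨ (i = min p q ∧ j = max p q)) := by
        intro i j hij
        simp only [reconnect]
        grind
      simp only [reconnect] at this
      grind
    · have : ∀ i j, i < j → ((d.bend hab.ne ha hb).partner (.inl i) = .inl j ↔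
          d.partner (.inl i) = .inl j ∨ (i = a ∧ j = b)) := by
        intro i j hij
        simp only [reconnect]
        grind
      simp only [reconnect] at this
      grind

/-- No cancellation occurs, so the decoration is the standard one up to order and up to the ends of
one diamond. The value of `γ` is irrelevant later: products are compared through `mul_eq_of_moves`,
or only up to a sign. -/
theorem exists_composes_bend (hab : a < b) (ha : d.partner (.inl a) = .inr p)
    (hb : d.partner (.inl b) = .inr q) :
    ∃ γ, Composes d (bar a b hab.ne) γ (d.bend hab.ne ha hb) := by
  obtain ⟨h, h'⟩ := connected_bend_bar hab.ne ha hb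
  obtain ⟨γ, hγ⟩ := Moves.exists_of_perm
    ((standardMarking_bend_perm hab ha hb).map (Marking.map StackDot.outer))
  simp only [List.map_append, List.map_cons, List.map_nil, Marking.map, StackDot.outer_inl,
    StackDot.outer_inr] at hγ
  refine ⟨0 + γ, not_hasLoop_of_retract _ h, h', .trans ?_ hγ⟩
  rw [stackMarking_bend_bar hab ha hb]
  rcases le_total p q with hpq | hpq
  · simpa [hpq] using Moves.refl (d.standardMarking.map (Marking.map StackDot.outer) ++
      [.cup (.top p) (.top q), .cap (.bot a) (.bot b)])
  · simpa [hpq] using Moves.cup_symm (d.standardMarking.map (Marking.map StackDot.outer))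
      [.cap (.bot a) (.bot b)] (.top p) (.top q)

end Bend

end BrauerDiagram

/-! ### Products of permutations and of arcs; diagrams with caps -/

namespace BrauerDiagram

variable {n : ℕ}

theorem connected_ofPerm (u w : Equiv.Perm (Fin n)) :
    (∀ i, Connected (ofPerm u) (ofPerm w) (.mid i) (.outer (.inr (u i)))) ∧
      IsStack (ofPerm u) (ofPerm w) (ofPerm (u * w)) := by
  have hr : ∀ i, Connected (ofPerm u) (ofPerm w) (.mid i) (.outer (.inr (u i))) := fun i =>
    connected_upper _ _ (x := .inl i) (y := .inr (u i)) rfl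
  have h : ∀ i, Connected (ofPerm u) (ofPerm w) (.bot i) (.top (u (w i))) := fun i =>
    (connected_lower (ofPerm u) (ofPerm w) (x := .inl i) (y := .inr (w i)) rfl).trans (hr (w i))
  refine ⟨hr, isStack_of_retract (fun i => .inr (u i)) ?_ ?_ ?_⟩
  · rintro (i | i)
    · exact h i
    · have := (h (w.symm (u.symm i))).symm
      rw [Equiv.apply_symm_apply, Equiv.apply_symm_apply] at this
      exact this
  · rintro (i | i) <;> simp [ofPerm]
  · rintro (i | i)
    · simp [ofPerm]
    · exact .inr (congrArg Sum.inl (congrArg w.symm (u.symm_apply_apply i).symm))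

theorem stackMarking_ofPerm (u w : Equiv.Perm (Fin n)) :
    stackMarking (ofPerm u) (ofPerm w) = [] := by
  simp [stackMarking, standardMarking_ofPerm]

theorem composes_ofPerm (u w : Equiv.Perm (Fin n)) :
    Composes (ofPerm u) (ofPerm w) 0 (ofPerm (u * w)) := by
  obtain ⟨h, h'⟩ := connected_ofPerm u w
  refine ⟨not_hasLoop_of_retract _ h, h', ?_⟩
  simpa [stackMarking_ofPerm, standardMarking_ofPerm] using Moves.refl _

theorem hasLoop_bar_bar {a b : Fin n} (hab : a ≠ b) : HasLoop (bar a b hab) (bar a b hab) := by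
  have key : ∀ x y, Connected (bar a b hab) (bar a b hab) x y →
      ((x = .mid a ∨ x = .mid b) ↔ (y = .mid a ∨ y = .mid b)) := by
    intro x y h
    induction h with
    | rel x y h =>
      rcases h with (i | i) | (i | i) <;> simp only [bar] <;> split_ifs <;> simp_all
    | refl => rfl
    | symm x y _ ih => exact ih.symm
    | trans x y z _ _ ih ih' => exact ih.trans ih'
  refine ⟨a, fun x h => ?_⟩
  have := (key _ _ h).1 (.inl rfl)
  rcases x with i | i <;> simp at this

/-- The curve from the lower dot `a` runs through the middle dots `a`, `b`, `c` to the upper dot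
`c`. Straightened, it is a propagating line of the transposition of `a` and `c`. -/
theorem connected_bar_bar {a b c : Fin n} (hab : a ≠ b) (hbc : b ≠ c) (hac : a ≠ c) :
    (∀ i, Connected (bar a b hab) (bar b c hbc) (.mid i)
      (.outer (if i = a ∨ i = b ∨ i = c then .inl a else .inl i))) ∧
    IsStack (bar a b hab) (bar b c hbc)
      ((ofPerm (Equiv.swap a c)).bend (a := c) (b := b) (p := a) (q := b) hbc.symm
        (by simp [ofPerm]) (by simp [ofPerm, Equiv.swap_apply_of_ne_of_ne hab.symm hbc])) := by
  have h₁ : Connected (bar a b hab) (bar b c hbc) (.bot a) (.mid a) :=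
    connected_lower _ (bar b c hbc) (x := .inl a) (y := .inr a) (by simp [bar, hab, hac])
  have h₂ : Connected (bar a b hab) (bar b c hbc) (.mid a) (.mid b) :=
    connected_upper (bar a b hab) _ (x := .inl a) (y := .inl b) (by simp [bar, hab])
  have h₃ : Connected (bar a b hab) (bar b c hbc) (.mid b) (.mid c) :=
    connected_lower _ (bar b c hbc) (x := .inr b) (y := .inr c) (by simp [bar, hbc])
  have h₄ : Connected (bar a b hab) (bar b c hbc) (.mid c) (.top c) :=
    connected_upper (bar a b hab) _ (x := .inl c) (y := .inr c) (by simp [bar, hbc.symm, hac.symm])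
  have h₅ : Connected (bar a b hab) (bar b c hbc) (.bot b) (.bot c) :=
    connected_lower _ (bar b c hbc) (x := .inl b) (y := .inl c) (by simp [bar, hbc])
  have h₆ : Connected (bar a b hab) (bar b c hbc) (.top a) (.top b) :=
    connected_upper (bar a b hab) _ (x := .inr a) (y := .inr b) (by simp [bar, hab])
  have h₇ : ∀ i, i ≠ b → i ≠ c → Connected (bar a b hab) (bar b c hbc) (.bot i) (.mid i) :=
    fun i hb hc => connected_lower _ (bar b c hbc) (x := .inl i) (y := .inr i)
      (by simp [bar, hb, hc])
  have h₈ : ∀ i, i ≠ a → i ≠ b → Connected (bar a b hab) (bar b c hbc) (.mid i) (.top i) :=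
    fun i ha hb => connected_upper (bar a b hab) _ (x := .inl i) (y := .inr i)
      (by simp [bar, ha, hb])
  have h₉ : Connected (bar a b hab) (bar b c hbc) (.bot a) (.top c) :=
    h₁.trans (h₂.trans (h₃.trans h₄))
  have hr : ∀ i, Connected (bar a b hab) (bar b c hbc) (.mid i)
      (.outer (if i = a ∨ i = b ∨ i = c then .inl a else .inl i)) := by
    intro i
    split_ifs with h
    · rcases h with rfl | rfl | rfl
      · exact h₁.symm
      · exact (h₁.trans h₂).symm
      · exact (h₁.trans (h₂.trans h₃)).symm
    · exact (h₇ i (by tauto) (by tauto)).symm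
  refine ⟨hr, isStack_of_retract (fun i => if i = a ∨ i = b ∨ i = c then .inl a else .inl i)
    ?_ ?_ ?_⟩
  · rintro (i | i)
    · rcases eq_or_ne i a with rfl | ha
      · simpa [reconnect, ofPerm, hab, hac, Equiv.swap_apply_def] using h₉
      rcases eq_or_ne i b with rfl | hb
      · simpa [reconnect, ofPerm, hbc] using h₅
      rcases eq_or_ne i c with rfl | hc
      · simpa [reconnect, ofPerm] using h₅.symm
      simpa [reconnect, ofPerm, ha, hb, hc, Equiv.swap_apply_def] 
        using (h₇ i hb hc).trans (h₈ i ha hb)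
    · rcases eq_or_ne i a with rfl | ha
      · simpa [reconnect, ofPerm, hbc, hab.symm, hac.symm, Equiv.swap_apply_def] using h₆
      rcases eq_or_ne i b with rfl | hb
      · simpa [reconnect, ofPerm, hbc, hab.symm, hac.symm, Equiv.swap_apply_def] using h₆.symm
      rcases eq_or_ne i c with rfl | hc
      · simpa [reconnect, ofPerm, hbc, hab.symm, hbc.symm, hac.symm, Equiv.swap_apply_def]
          using h₉.symm
      simpa [reconnect, ofPerm, ha, hb, hc, hbc, hab.symm, hac.symm, Equiv.swap_apply_def]
        using ((h₇ i hb hc).trans (h₈ i ha hb)).symm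
  · rintro (i | i) <;> simp only [bar, reconnect, ofPerm, Equiv.swap_apply_def, Equiv.symm_swap] <;>
      grind
  · rintro (i | i) <;> simp only [bar, reconnect, ofPerm, Equiv.swap_apply_def, Equiv.symm_swap] <;>
      grind

/-- On the zigzag the arrow of the upper cap points to the diamond of the lower cup, so the two
cancel without a sign. -/
theorem stackMarking_bar_bar {a b c : Fin n} (hab : a < b) (hbc : b < c) :
    Moves (stackMarking (bar a b hab.ne) (bar b c hbc.ne)) 0
      [.cup (.top a) (.top b), .cap (.bot b) (.bot c)] := by
  have hac := hab.trans hbc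
  have : stackMarking (bar a b hab.ne) (bar b c hbc.ne) =
      [.cup (.top a) (.top b)] ++ .cap (.bot a) (.mid b) :: .cup (.mid b) (.top c) ::
        [.cap (.bot b) (.bot c)] := by
    rw [stackMarking, standardMarking_bar hab, standardMarking_bar hbc]
    simp [Marking.map, upperEnd, lowerEnd, bar, hab.ne, hac.ne, hbc.ne, hac.ne', hbc.ne']
  rw [this]
  simpa [Marking.map, hac.ne, hbc.ne] using
    Moves.cancel_left [.cup (.top a) (.top b)] [.cap (.bot b) (.bot c)]
      (.bot a) (.mid b) (.top c : StackDot n)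

/-- Without caps, the partners of the lower dots are distinct upper dots, hence by finiteness all
upper dots. -/
theorem hasCap_of_hasCup {d : BrauerDiagram n} (h : d.HasCup) : d.HasCap := by
  have hpp := d.partner_partner
  by_contra hd
  have : ∀ i, ∃ j, d.partner (.inl i) = .inr j := by
    intro i
    rcases hi : d.partner (.inl i) with j | j
    · exact absurd ⟨i, j, hi⟩ hd
    · exact ⟨j, rfl⟩
  choose f hf using this
  obtain ⟨i, j, hij⟩ := h
  have hfi : Function.Injective f := fun a b hab => by
    have ha := hf a; have hb := hf b; grind
  obtain ⟨a, ha⟩ := Finite.surjective_of_injective hfi i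
  have := hf a
  grind

theorem hasCup_of_hasCap {d : BrauerDiagram n} (h : d.HasCap) : d.HasCup := by
  have hpp := d.partner_partner
  by_contra hd
  have : ∀ i, ∃ j, d.partner (.inr i) = .inl j := by
    intro i
    rcases hi : d.partner (.inr i) with j | j
    · exact ⟨j, rfl⟩
    · exact absurd ⟨i, j, hi⟩ hd
  choose f hf using this
  obtain ⟨i, j, hij⟩ := h
  have hfi : Function.Injective f := fun a b hab => by
    have ha := hf a; have hb := hf b; grind
  obtain ⟨a, ha⟩ := Finite.surjective_of_injective hfi i
  have := hf a
  grind

theorem exists_eq_ofPerm {d : BrauerDiagram n} (hd : ¬ d.HasCap) :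
    ∃ w : Equiv.Perm (Fin n), d = ofPerm w := by
  have hpp := d.partner_partner
  have h₁ : ∀ i, ∃ j, d.partner (.inl i) = .inr j := by
    intro i
    rcases hi : d.partner (.inl i) with j | j
    · exact absurd ⟨i, j, hi⟩ hd
    · exact ⟨j, rfl⟩
  have h₂ : ∀ i, ∃ j, d.partner (.inr i) = .inl j := by
    intro i
    rcases hi : d.partner (.inr i) with j | j
    · exact ⟨j, rfl⟩
    · exact absurd (hasCap_of_hasCup ⟨i, j, hi⟩) hd
  choose f hf using h₁
  choose g hg using h₂
  refine ⟨⟨f, g, fun i => ?_, fun i => ?_⟩, ?_⟩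
  · have := hf i; have := hg (f i); grind
  · have := hg i; have := hf (g i); grind
  · ext1
    funext x
    rcases x with i | i
    · simp [ofPerm, hf]
    · simp [ofPerm, hg]

theorem not_hasCap_ofPerm (w : Equiv.Perm (Fin n)) : ¬ (ofPerm w).HasCap := by
  rintro ⟨i, j, h⟩
  simp [ofPerm] at h

/-- A diagram with a cap arises by bending two propagating lines of a diagram with fewer caps. -/
theorem HasCap.exists_eq_bend {d : BrauerDiagram n} (h : d.HasCap) :
    ∃ (d' : BrauerDiagram n) (a b p q : Fin n) (hab : a < b) (ha : d'.partner (.inl a) = .inr p)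
      (hb : d'.partner (.inl b) = .inr q), d = d'.bend hab.ne ha hb := by
  have hpp := d.partner_partner
  have hne := d.partner_ne
  obtain ⟨a, b, hab, h₁⟩ : ∃ a b, a < b ∧ d.partner (.inl a) = .inl b := by
    obtain ⟨a, b, hab⟩ := h
    rcases lt_trichotomy a b with h' | h' | h'
    · exact ⟨a, b, h', hab⟩
    · exact absurd hab (h' ▸ hne _)
    · exact ⟨b, a, h', by grind⟩
  obtain ⟨p, q, h₂⟩ := hasCup_of_hasCap h
  have h₃ := hpp (.inl a)
  have h₄ := hpp (.inr p)
  rw [h₁] at h₃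
  rw [h₂] at h₄
  -- Undo the bending: replace the cap on `a`, `b` and the cup on `p`, `q` by lines from `a` to `p`
  -- and from `b` to `q`.
  have ha : (d.reconnect (.inl a) (.inr p) (by simp) (by simp [h₁])).partner (.inl a) = .inr p := by
    simp [reconnect]
  have hb : (d.reconnect (.inl a) (.inr p) (by simp) (by simp [h₁])).partner (.inl b) = .inr q := by
    simp [reconnect, h₁, h₂, hab.ne']
  refine ⟨_, a, b, p, q, hab, ha, hb, ?_⟩
  ext1
  funext x
  simp only [reconnect, h₁, h₂]
  grind

theorem length_standardMarking_bend {d : BrauerDiagram n} {a b p q : Fin n} (hab : a < b)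
    (ha : d.partner (.inl a) = .inr p) (hb : d.partner (.inl b) = .inr q) :
    (d.bend hab.ne ha hb).standardMarking.length = d.standardMarking.length + 2 := by
  simpa using (standardMarking_bend_perm hab ha hb).length_eq.symm

end BrauerDiagram


/-! ### Relations between permutations and arcs -/

open BrauerDiagram in
/-- A map from the Brauer diagrams to an algebra that is compatible with the multiplication rule of
diagrams. -/
structure DiagramRep (k : Type*) [Field k] (n : ℕ) (A : Type*) [Ring A] [Algebra k A] where
  toFun : BrauerDiagram n → A
  toFun_one : toFun (ofPerm 1) = 1
  mul_of_hasLoop : ∀ {d₁ d₂}, HasLoop d₁ d₂ → toFun d₁ * toFun d₂ = 0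
  mul_of_composes : ∀ {d₁ d₂ d γ}, Composes d₁ d₂ γ d →
    toFun d₁ * toFun d₂ = (-1 : k) ^ γ • toFun d

namespace DiagramRep

open BrauerDiagram

variable {k : Type*} [Field k] {n : ℕ} {A : Type*} [Ring A] [Algebra k A] (ρ : DiagramRep k n A)

/-- Products of diagrams whose stacks give the same diagram with decorations connected by moves. -/
theorem mul_eq_of_moves {d₁ d₂ d₁' d₂' d : BrauerDiagram n} {γ γ' : ℕ}
    (h : Composes d₁' d₂' γ' d) (hl : ¬ HasLoop d₁ d₂) (hs : IsStack d₁ d₂ d)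
    (hm : Moves (stackMarking d₁ d₂) γ (stackMarking d₁' d₂')) :
    ρ.toFun d₁ * ρ.toFun d₂ = (-1 : k) ^ γ • (ρ.toFun d₁' * ρ.toFun d₂') := by
  rw [ρ.mul_of_composes h, ρ.mul_of_composes ⟨hl, hs, hm.trans h.2.2⟩,
    smul_smul, pow_add]

/-- The embedding of the symmetric group. -/
noncomputable def perm : Equiv.Perm (Fin n) →* A where
  toFun w := ρ.toFun (ofPerm w)
  map_one' := by
    exact ρ.toFun_one
  map_mul' u w := by
    simpa using (ρ.mul_of_composes (composes_ofPerm u w)).symm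

theorem toFun_ofPerm (w : Equiv.Perm (Fin n)) : ρ.toFun (ofPerm w) = ρ.perm w := rfl

/-- The diagram `bar a b`, made skew symmetric in `a` and `b`. -/
noncomputable def arc (a b : Fin n) : A :=
  if h : a < b then ρ.toFun (bar a b h.ne)
  else if h : b < a then -ρ.toFun (bar b a h.ne) else 0

theorem arc_of_lt {a b : Fin n} (h : a < b) : ρ.arc a b = ρ.toFun (bar a b h.ne) := by
  simp [arc, h]

theorem arc_swap (a b : Fin n) : ρ.arc b a = -ρ.arc a b := by
  rcases lt_trichotomy a b with h | rfl | h
  · simp [arc, h, h.not_gt]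
  · simp [arc]
  · simp [arc, h, h.not_gt]

theorem arc_mul_self (a b : Fin n) : ρ.arc a b * ρ.arc a b = 0 := by
  rcases lt_trichotomy a b with h | rfl | h
  · rw [ρ.arc_of_lt h, ρ.mul_of_hasLoop (hasLoop_bar_bar _)]
  · simp [arc]
  · rw [arc_swap, ρ.arc_of_lt h, neg_mul_neg, ρ.mul_of_hasLoop (hasLoop_bar_bar _)]

/-- Both stacks give the same bent diagram. If `w` reverses the order of `a` and `b`, the
decorations differ by exchanging the ends of a diamond and reversing an arrow; the resulting sign is
absorbed by the skew symmetry of `arc`. -/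
theorem perm_mul_arc_of_lt (w : Equiv.Perm (Fin n)) {a b : Fin n} (hab : a < b) :
    ρ.perm w * ρ.arc a b = ρ.arc (w a) (w b) * ρ.perm w := by
  have ha : (ofPerm w).partner (.inl a) = .inr (w a) := rfl
  have hb : (ofPerm w).partner (.inl b) = .inr (w b) := rfl
  obtain ⟨hr, hs⟩ := connected_bend_bar hab.ne ha hb
  obtain ⟨γ, h⟩ := exists_composes_bend hab ha hb
  have hm := stackMarking_bend_bar hab ha hb
  rw [standardMarking_ofPerm] at hm
  rw [ρ.arc_of_lt hab, ← toFun_ofPerm]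
  rcases lt_or_gt_of_ne (ne_of_partner_ne hab.ne ha hb) with hpq | hpq
  · obtain ⟨hr', hs'⟩ := connected_bar_bend hab.ne ha hb hpq.ne
    have hm' := stackMarking_bar_bend hpq ha hb
    rw [standardMarking_ofPerm] at hm'
    rw [ρ.arc_of_lt hpq, ρ.mul_eq_of_moves h (not_hasLoop_of_retract _ hr') hs' (γ := 0)]
    · simp
    · rw [hm, hm']; exact .refl _
  · obtain ⟨hr', hs'⟩ := connected_bar_bend hab.ne ha hb hpq.ne'
    have hm' := stackMarking_bar_bend hpq hb ha
    rw [standardMarking_ofPerm] at hm'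
    simp_rw [bar_comm hpq.ne'] at hs' hr'
    rw [arc_swap, ρ.arc_of_lt hpq, neg_mul,
      ρ.mul_eq_of_moves h (not_hasLoop_of_retract _ hr') hs' (γ := 0 + 1)]
    · simp
    · rw [hm, hm']
      exact .trans (.cup_symm [] [.cap _ _] _ _) (.cap_rev [.cup _ _] [] _ _)

theorem perm_mul_arc (w : Equiv.Perm (Fin n)) (a b : Fin n) :
    ρ.perm w * ρ.arc a b = ρ.arc (w a) (w b) * ρ.perm w := by
  rcases lt_trichotomy a b with h | rfl | h
  · exact ρ.perm_mul_arc_of_lt w h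
  · simp [arc]
  · rw [ρ.arc_swap b a, ρ.arc_swap (w b), mul_neg, neg_mul, ρ.perm_mul_arc_of_lt w h]

/-- The image of a transposition. -/
noncomputable def transposition (a b : Fin n) : A :=
  ρ.perm (Equiv.swap a b)

theorem perm_mul_transposition (w : Equiv.Perm (Fin n)) (a b : Fin n) :
    ρ.perm w * ρ.transposition a b = ρ.transposition (w a) (w b) * ρ.perm w := by
  rw [transposition, transposition, ← map_mul, ← map_mul, Equiv.mul_swap_eq_swap_mul]

theorem transposition_comm (a b : Fin n) : ρ.transposition a b = ρ.transposition b a := by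
  rw [transposition, Equiv.swap_comm]; rfl

theorem transposition_mul_self (a b : Fin n) : ρ.transposition a b * ρ.transposition a b = 1 := by
  simp [transposition, ← map_mul]

/-- On this side the transposition only exchanges the ends of the diamond, which costs nothing. On
the other side it reverses the arrow, whence the sign in `arc_mul_transposition`. -/
theorem transposition_mul_arc (a b : Fin n) : ρ.transposition a b * ρ.arc a b = ρ.arc a b := by
  wlog hab : a < b generalizing a b
  · rcases eq_or_ne a b with rfl | h
    · simp [arc]
    · rw [transposition_comm, arc_swap, mul_neg, this b a (lt_of_le_of_ne (not_lt.1 hab) h.symm)]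
  have ha : (ofPerm (Equiv.swap a b)).partner (.inl a) = .inr b := by simp [ofPerm]
  have hb : (ofPerm (Equiv.swap a b)).partner (.inl b) = .inr a := by simp [ofPerm]
  obtain ⟨hr, hs⟩ := connected_bend_bar hab.ne ha hb
  have hm := stackMarking_bend_bar hab ha hb
  rw [standardMarking_ofPerm] at hm
  have hd : (ofPerm (Equiv.swap a b)).bend hab.ne ha hb = bar a b hab.ne := by
    ext1
    funext x
    rcases x with x | x <;>
      simp only [reconnect, bar, ofPerm, Equiv.symm_swap, Equiv.swap_apply_def] <;> grind
  rw [hd] at hs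
  rw [ρ.arc_of_lt hab, transposition, ← toFun_ofPerm,
    ρ.mul_of_composes (γ := 0) ⟨not_hasLoop_of_retract _ hr, hs, ?_⟩]
  · simp
  · rw [hm, standardMarking_bar hab]
    exact .cup_symm [] [.cap _ _] _ _

theorem arc_mul_transposition (a b : Fin n) : ρ.arc a b * ρ.transposition a b = -ρ.arc a b := by
  have h := ρ.perm_mul_arc (Equiv.swap a b) b a
  rw [Equiv.swap_apply_left, Equiv.swap_apply_right, arc_swap, mul_neg] at h
  exact h.symm.trans (congrArg _ (ρ.transposition_mul_arc a b))

theorem arc_commute_arc {a b c d : Fin n} (hac : a ≠ c) (had : a ≠ d) (hbc : b ≠ c) (hbd : b ≠ d) :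
    Commute (ρ.arc a b) (ρ.arc c d) := by
  wlog hab : a < b generalizing a b
  · rcases eq_or_ne a b with rfl | h
    · simp [arc]
    · rw [arc_swap]
      exact (this hbc hbd hac had (lt_of_le_of_ne (not_lt.1 hab) h.symm)).neg_left
  wlog hcd : c < d generalizing c d
  · rcases eq_or_ne c d with rfl | h
    · simp [arc]
    · rw [ρ.arc_swap d c]
      exact (this had hac hbd hbc (lt_of_le_of_ne (not_lt.1 hcd) h.symm)).neg_right
  have hc : (bar a b hab.ne).partner (.inl c) = .inr c := by simp [bar, hac.symm, hbc.symm]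
  have hd : (bar a b hab.ne).partner (.inl d) = .inr d := by simp [bar, had.symm, hbd.symm]
  obtain ⟨γ, h⟩ := exists_composes_bend hcd hc hd
  obtain ⟨hr, hs⟩ := connected_bar_bend hcd.ne hc hd hcd.ne
  have hm := stackMarking_bend_bar hcd hc hd
  have hm' := stackMarking_bar_bend hcd hc hd
  rw [standardMarking_bar hab] at hm hm'
  rw [ρ.arc_of_lt hab, ρ.arc_of_lt hcd]
  refine ((ρ.mul_eq_of_moves h (not_hasLoop_of_retract _ hr) hs
    (γ := 1 + (1 + (1 + 1))) ?_).trans (by norm_num)).symm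
  rw [hm, hm']
  -- Moving a cup and a cap past a cup and a cap takes four exchanges of heights, an even number of
  -- signs.
  exact .trans (.swap [.cup _ _] [.cap _ _] _ _) (.trans (.swap [] [.cap _ _, .cap _ _] _ _)
    (.trans (.swap [.cup _ _, .cup _ _] [] _ _) (.swap [.cup _ _] [.cap _ _] _ _)))

theorem arc_mul_arc_of_lt {a b c : Fin n} (hab : a < b) (hbc : b < c) :
    ρ.arc a b * ρ.arc b c = -(ρ.arc a b * ρ.transposition a c) := by
  have hac := hab.trans hbc
  have hc : (ofPerm (Equiv.swap a c)).partner (.inl c) = .inr a := by simp [ofPerm]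
  have hb : (ofPerm (Equiv.swap a c)).partner (.inl b) = .inr b := by
    simp [ofPerm, Equiv.swap_apply_of_ne_of_ne hab.ne' hbc.ne]
  obtain ⟨hr, hs⟩ := connected_bar_bar hab.ne hbc.ne hac.ne
  obtain ⟨hr', hs'⟩ := connected_bar_bend hbc.ne' hc hb hab.ne
  have hm' := stackMarking_bar_bend hab hc hb
  rw [standardMarking_ofPerm] at hm'
  obtain ⟨γ, hγ⟩ := exists_composes_bend hbc hb hc
  have hd : (ofPerm (Equiv.swap a c)).bend hbc.ne hb hc =
      (ofPerm (Equiv.swap a c)).bend hbc.ne' hc hb := by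
    ext1
    funext x
    simp only [reconnect]
    grind
  rw [hd] at hγ
  have hm := stackMarking_bend_bar hbc hb hc
  rw [standardMarking_ofPerm] at hm
  have hm₁ : Moves (stackMarking (bar a b hab.ne) (ofPerm (Equiv.swap a c))) 1
      [.cup (.top a) (.top b), .cap (.bot b) (.bot c)] := by
    rw [hm']
    exact .cap_rev [.cup _ _] [] _ _
  have hm₂ : Moves [.cup (.top a) (.top b), .cap (.bot b) (.bot c)] 1
      (stackMarking (bar a b hab.ne) (ofPerm (Equiv.swap a c))) := by
    rw [hm']
    exact .cap_rev [.cup _ _] [] _ _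
  have hm₃ : Moves [.cup (.top a) (.top b), .cap (.bot b) (.bot c)] 0
      (stackMarking (ofPerm (Equiv.swap a c)) (bar b c hbc.ne)) := by
    rw [hm]
    exact .cup_symm [] [.cap _ _] _ _
  -- `exists_composes_bend` treats the permutation on top of an arc. Moves linking the two
  -- decorations carry its path to the standard marking over to the stack with the permutation
  -- below.
  have hcomp : Composes (bar a b hab.ne) (ofPerm (Equiv.swap a c)) (1 + (0 + γ)) _ :=
    ⟨not_hasLoop_of_retract _ hr', hs', hm₁.trans (hm₃.trans hγ.2.2)⟩
  rw [ρ.arc_of_lt hab, ρ.arc_of_lt hbc, transposition, ← toFun_ofPerm,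
    ρ.mul_eq_of_moves hcomp (not_hasLoop_of_retract _ hr) hs
      ((stackMarking_bar_bar hab hbc).trans hm₂)]
  simp

theorem arc_mul_arc_perm (w : Equiv.Perm (Fin n)) {a b c : Fin n}
    (h : ρ.arc a b * ρ.arc b c = -(ρ.arc a b * ρ.transposition a c)) :
    ρ.arc (w a) (w b) * ρ.arc (w b) (w c) =
      -(ρ.arc (w a) (w b) * ρ.transposition (w a) (w c)) := by
  have hw : ρ.perm w * ρ.perm w⁻¹ = 1 := by
    rw [← map_mul, mul_inv_cancel, map_one]
  have h₁ : ρ.perm w * (ρ.arc a b * ρ.arc b c) =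
      ρ.arc (w a) (w b) * ρ.arc (w b) (w c) * ρ.perm w := by
    rw [← mul_assoc, perm_mul_arc, mul_assoc, perm_mul_arc, mul_assoc]
  have h₂ : ρ.perm w * -(ρ.arc a b * ρ.transposition a c) =
      -(ρ.arc (w a) (w b) * ρ.transposition (w a) (w c)) * ρ.perm w := by
    rw [mul_neg, ← mul_assoc, perm_mul_arc, mul_assoc, perm_mul_transposition, neg_mul, mul_assoc]
  have := congrArg (· * ρ.perm w⁻¹) (h₁.symm.trans ((congrArg _ h).trans h₂))
  simpa only [mul_assoc, hw, mul_one] using this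

/-- The relation is stable under conjugation by permutations, so every relative order of the three
dots reduces to the increasing one. -/
theorem arc_mul_arc {a b c : Fin n} (hab : a ≠ b) (hbc : b ≠ c) (hac : a ≠ c) :
    ρ.arc a b * ρ.arc b c = -(ρ.arc a b * ρ.transposition a c) := by
  have h₁ : ∀ {a b c : Fin n}, a ≠ b → b ≠ c → a ≠ c →
      ρ.arc a b * ρ.arc b c = -(ρ.arc a b * ρ.transposition a c) →
      ρ.arc b a * ρ.arc a c = -(ρ.arc b a * ρ.transposition b c) := by
    intro a b c hab hbc hac h
    simpa [Equiv.swap_apply_of_ne_of_ne hac.symm hbc.symm] using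
      ρ.arc_mul_arc_perm (Equiv.swap a b) h
  have h₂ : ∀ {a b c : Fin n}, a ≠ b → b ≠ c → a ≠ c →
      ρ.arc a b * ρ.arc b c = -(ρ.arc a b * ρ.transposition a c) →
      ρ.arc a c * ρ.arc c b = -(ρ.arc a c * ρ.transposition a b) := by
    intro a b c hab hbc hac h
    simpa [Equiv.swap_apply_of_ne_of_ne hab hac] using
      ρ.arc_mul_arc_perm (Equiv.swap b c) h
  rcases lt_or_gt_of_ne hab with h | h <;> rcases lt_or_gt_of_ne hbc with h' | h' <;>
    rcases lt_or_gt_of_ne hac with h'' | h''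
  · exact ρ.arc_mul_arc_of_lt h h'
  · order
  · exact h₂ hac hbc.symm hab (ρ.arc_mul_arc_of_lt h'' h')
  · exact h₂ hac hbc.symm hab (h₁ hac.symm hab hbc.symm (ρ.arc_mul_arc_of_lt h'' h))
  · exact h₁ hab.symm hac hbc (ρ.arc_mul_arc_of_lt h h'')
  · exact h₁ hab.symm hac hbc (h₂ hbc hac.symm hab.symm (ρ.arc_mul_arc_of_lt h' h''))
  · order
  · exact h₁ hab.symm hac hbc (h₂ hbc hac.symm hab.symm (h₁ hbc.symm hab.symm hac.symm
      (ρ.arc_mul_arc_of_lt h' h)))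

end DiagramRep

/-! ### Jucys–Murphy elements -/

namespace DiagramRep

variable {k : Type*} [Field k] {n : ℕ} {A : Type*} [Ring A] [Algebra k A] (ρ : DiagramRep k n A)

theorem arc_mul_arc_right {a b c : Fin n} (hab : a ≠ b) (hbc : b ≠ c) (hac : a ≠ c) :
    ρ.arc a b * ρ.arc c b = ρ.arc a b * ρ.transposition a c := by
  rw [ρ.arc_swap b c, mul_neg, ρ.arc_mul_arc hab hbc hac, neg_neg]

theorem arc_mul_arc_left {a b c : Fin n} (hab : a ≠ b) (hbc : b ≠ c) (hac : a ≠ c) :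
    ρ.arc a b * ρ.arc c a = ρ.arc a b * ρ.transposition b c := by
  rw [ρ.arc_swap b a, neg_mul, neg_mul, ρ.arc_mul_arc_right hab.symm hac hbc]

theorem arc_mul_transposition_of_ne {a b c : Fin n} (hab : a ≠ b) (hbc : b ≠ c) :
    ρ.arc a b * ρ.transposition a c = ρ.transposition a c * ρ.arc c b := by
  have := ρ.perm_mul_arc (Equiv.swap a c) c b
  rw [Equiv.swap_apply_right, Equiv.swap_apply_of_ne_of_ne hab.symm hbc] at this
  exact this.symm

theorem arc_left_mul_arc {a b c : Fin n} (hab : a ≠ b) (hbc : b ≠ c) (hac : a ≠ c) :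
    ρ.arc c a * ρ.arc a b = ρ.transposition c b * ρ.arc a b := by
  rw [ρ.arc_mul_arc hac.symm hab hbc.symm, ρ.arc_mul_transposition_of_ne hac.symm hab,
    ρ.arc_swap a b, mul_neg, neg_neg]

theorem arc_right_mul_arc {a b c : Fin n} (hab : a ≠ b) (hbc : b ≠ c) (hac : a ≠ c) :
    ρ.arc c b * ρ.arc a b = ρ.transposition c a * ρ.arc a b := by
  rw [ρ.arc_swap b a, mul_neg, mul_neg, ρ.arc_left_mul_arc hab.symm hac hbc]

/-- The summands of the Jucys–Murphy elements. -/
noncomputable def jmTerm (j i : Fin n) : A := ρ.transposition j i + ρ.arc j i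

/-- The Jucys–Murphy elements. -/
noncomputable def jm (i : Fin n) : A := ∑ j ∈ Finset.Iio i, ρ.jmTerm j i

theorem perm_mul_jmTerm (w : Equiv.Perm (Fin n)) (j i : Fin n) :
    ρ.perm w * ρ.jmTerm j i = ρ.jmTerm (w j) (w i) * ρ.perm w := by
  rw [jmTerm, jmTerm, mul_add, add_mul, perm_mul_arc, perm_mul_transposition]

theorem perm_commute_jm {w : Equiv.Perm (Fin n)} {i : Fin n} (hi : w i = i)
    (h : ∀ l, w l < i ↔ l < i) : Commute (ρ.perm w) (ρ.jm i) := by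
  rw [Commute, SemiconjBy, jm, Finset.mul_sum, Finset.sum_mul]
  refine Finset.sum_equiv w (fun l => by simp [h]) fun l _ => ?_
  rw [perm_mul_jmTerm, hi]

theorem arc_mul_jmTerm_add {a b i : Fin n} (hab : a ≠ b) (hai : a ≠ i) (hbi : b ≠ i) :
    ρ.arc a b * (ρ.jmTerm a i + ρ.jmTerm b i) = 0 := by
  simp only [jmTerm, mul_add]
  rw [ρ.arc_mul_arc hab hbi hai, ρ.arc_swap i a, mul_neg, ρ.arc_mul_arc_left hab hbi hai]
  abel

theorem jmTerm_add_mul_arc {a b i : Fin n} (hab : a ≠ b) (hai : a ≠ i) (hbi : b ≠ i) :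
    (ρ.jmTerm a i + ρ.jmTerm b i) * ρ.arc a b = 0 := by
  simp only [jmTerm, add_mul]
  rw [ρ.arc_swap i a, ρ.arc_swap i b, neg_mul, neg_mul, ρ.arc_left_mul_arc hab hbi hai,
    ρ.arc_right_mul_arc hab hbi hai, ρ.transposition_comm a i, ρ.transposition_comm b i]
  abel

theorem jm_eq_add {a b i : Fin n} (hab : a ≠ b) (ha : a < i) (hb : b < i) :
    ρ.jm i = (ρ.jmTerm a i + ρ.jmTerm b i) +
      ∑ l ∈ ((Finset.Iio i).erase a).erase b, ρ.jmTerm l i := by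
  rw [jm, add_assoc, Finset.add_sum_erase _ (fun l => ρ.jmTerm l i) (by simp [hb, hab.symm]),
    Finset.add_sum_erase _ (fun l => ρ.jmTerm l i) (by simp [ha])]

/-- The two terms of `jm i` that involve `a` or `b` have a sum annihilated by the arc on both sides;
the other terms are disjoint from the arc and commute with it. -/
theorem arc_commute_jm {a b i : Fin n} (ha : a < i) (hb : b < i) :
    Commute (ρ.arc a b) (ρ.jm i) := by
  rcases eq_or_ne a b with rfl | hab
  · simp [arc]
  rw [ρ.jm_eq_add hab ha hb]
  refine .add_right ?_ (Commute.sum_right _ _ _ fun l hl => ?_)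
  · rw [Commute, SemiconjBy, ρ.arc_mul_jmTerm_add hab ha.ne hb.ne,
      ρ.jmTerm_add_mul_arc hab ha.ne hb.ne]
  · simp only [Finset.mem_erase] at hl
    refine .add_right ?_ (ρ.arc_commute_arc hl.2.1.symm ha.ne hl.1.symm hb.ne)
    have := ρ.perm_mul_arc (Equiv.swap l i) a b
    rw [Equiv.swap_apply_of_ne_of_ne hl.2.1.symm ha.ne,
      Equiv.swap_apply_of_ne_of_ne hl.1.symm hb.ne] at this
    exact this.symm

theorem jm_commute (i j : Fin n) : Commute (ρ.jm i) (ρ.jm j) := by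
  wlog hij : i < j generalizing i j
  · rcases eq_or_ne i j with rfl | h
    · exact Commute.refl _
    · exact (this j i (lt_of_le_of_ne (not_lt.1 hij) h.symm)).symm
  refine Commute.sum_left _ _ _ fun l hl => ?_
  have hl : l < j := (Finset.mem_Iio.1 hl).trans hij
  refine .add_left (ρ.perm_commute_jm ?_ ?_) (ρ.arc_commute_jm hl hij)
  · exact Equiv.swap_apply_of_ne_of_ne hl.ne' hij.ne'
  · intro m
    rw [Equiv.swap_apply_def]
    split_ifs with h h'
    · simp [h, hl, hij]
    · simp [h', hl, hij]
    · rfl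

/-! ### Adjacent dots and the factors of `Θ` -/

section Adjacent

variable {p q : Fin n}

theorem Iio_of_adjacent (hpq : (p : ℕ) + 1 = q) : Finset.Iio q = insert p (Finset.Iio p) := by
  ext l
  simp only [Finset.mem_Iio, Finset.mem_insert, Fin.lt_def, Fin.ext_iff]
  omega

theorem ne_of_adjacent (hpq : (p : ℕ) + 1 = q) : p ≠ q := by
  rintro rfl
  omega

theorem jm_of_adjacent (hpq : (p : ℕ) + 1 = q) :
    ρ.jm q = ρ.jmTerm p q + ∑ l ∈ Finset.Iio p, ρ.jmTerm l q := by
  rw [jm, Iio_of_adjacent hpq, Finset.sum_insert (by simp)]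

/-- Conjugation by the transposition turns the terms of `jm p` into those of `jm q` other than
`jmTerm p q`; the remaining term contributes `-1 + arc p q`. -/
theorem transposition_mul_jm_left (hpq : (p : ℕ) + 1 = q) :
    ρ.transposition p q * ρ.jm p = ρ.jm q * ρ.transposition p q - 1 + ρ.arc p q := by
  have : ρ.transposition p q * ρ.jm p =
      (∑ l ∈ Finset.Iio p, ρ.jmTerm l q) * ρ.transposition p q := by
    rw [jm, Finset.mul_sum, Finset.sum_mul]
    refine Finset.sum_congr rfl fun l hl => ?_
    have hl := Finset.mem_Iio.1 hl
    rw [transposition, perm_mul_jmTerm, Equiv.swap_apply_left, Equiv.swap_apply_of_ne_of_ne hl.ne]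
    rintro rfl
    rw [Fin.lt_def] at hl
    omega
  rw [this, jm_of_adjacent ρ hpq, jmTerm, add_mul, add_mul, transposition_mul_self,
    arc_mul_transposition]
  abel

theorem transposition_mul_jm_right (hpq : (p : ℕ) + 1 = q) :
    ρ.transposition p q * ρ.jm q = ρ.jm p * ρ.transposition p q + 1 + ρ.arc p q := by
  have h := congrArg (fun x => ρ.transposition p q * x * ρ.transposition p q)
    (ρ.transposition_mul_jm_left hpq)
  simp only [← mul_assoc, transposition_mul_self, one_mul, mul_add, add_mul, mul_sub, sub_mul,
    mul_one, transposition_mul_arc, arc_mul_transposition] at h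
  rw [mul_assoc _ (ρ.transposition p q), transposition_mul_self, mul_one] at h
  rw [h]
  abel

/-- After multiplication by the arc, the arc from `l` to one of `p`, `q` acts as the transposition
of `l` with the other. So the terms of index `l` in `jm p` and `jm q` cancel, and only `jmTerm p q`
is left. -/
theorem arc_mul_jm_sub (hpq : (p : ℕ) + 1 = q) :
    ρ.arc p q * (ρ.jm p - ρ.jm q) = ρ.arc p q := by
  have : ρ.arc p q * ρ.jm p = ρ.arc p q * ∑ l ∈ Finset.Iio p, ρ.jmTerm l q := by
    rw [jm, Finset.mul_sum, Finset.mul_sum]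
    refine Finset.sum_congr rfl fun l hl => ?_
    have hl := (Finset.mem_Iio.1 hl).ne'
    have hl' : q ≠ l := by
      rintro rfl
      rw [Finset.mem_Iio, Fin.lt_def] at *
      omega
    have hpq := ne_of_adjacent hpq
    rw [jmTerm, jmTerm, mul_add, mul_add, ρ.arc_mul_arc_left hpq hl' hl,
      ρ.arc_mul_arc_right hpq hl' hl, ρ.transposition_comm l, ρ.transposition_comm l, add_comm]
  rw [mul_sub, this, jm_of_adjacent ρ hpq, mul_add, jmTerm, mul_add, arc_mul_transposition,
    arc_mul_self]
  abel

theorem jm_sub_mul_arc (hpq : (p : ℕ) + 1 = q) :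
    (ρ.jm p - ρ.jm q) * ρ.arc p q = -ρ.arc p q := by
  have : ρ.jm p * ρ.arc p q = (∑ l ∈ Finset.Iio p, ρ.jmTerm l q) * ρ.arc p q := by
    rw [jm, Finset.sum_mul, Finset.sum_mul]
    refine Finset.sum_congr rfl fun l hl => ?_
    have hl := (Finset.mem_Iio.1 hl).ne'
    have hl' : q ≠ l := by
      rintro rfl
      rw [Finset.mem_Iio, Fin.lt_def] at *
      omega
    have hpq := ne_of_adjacent hpq
    rw [jmTerm, jmTerm, add_mul, add_mul, ρ.arc_left_mul_arc hpq hl' hl,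
      ρ.arc_right_mul_arc hpq hl' hl, add_comm]
  rw [sub_mul, this, jm_of_adjacent ρ hpq, add_mul, jmTerm, add_mul, transposition_mul_arc,
    arc_mul_self]
  abel

/-- The factors of `Θ`. -/
noncomputable def thetaFactor (p q : Fin n) : A := 1 - (ρ.jm p - ρ.jm q) ^ 2

theorem arc_mul_thetaFactor (hpq : (p : ℕ) + 1 = q) : ρ.arc p q * ρ.thetaFactor p q = 0 := by
  rw [thetaFactor, mul_sub, pow_two, ← mul_assoc, arc_mul_jm_sub ρ hpq, arc_mul_jm_sub ρ hpq,
    mul_one, sub_self]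

theorem thetaFactor_mul_arc (hpq : (p : ℕ) + 1 = q) : ρ.thetaFactor p q * ρ.arc p q = 0 := by
  rw [thetaFactor, sub_mul, pow_two, mul_assoc, jm_sub_mul_arc ρ hpq, mul_neg,
    jm_sub_mul_arc ρ hpq, one_mul, neg_neg, sub_self]

theorem transposition_commute_thetaFactor (hpq : (p : ℕ) + 1 = q) :
    Commute (ρ.transposition p q) (ρ.thetaFactor p q) := by
  -- The arcs in the two commutation rules cancel in the difference. From `s y = -y s - 2` it
  -- follows that `s` commutes with `y²`.
  have h : ρ.transposition p q * (ρ.jm p - ρ.jm q) =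
      -((ρ.jm p - ρ.jm q) * ρ.transposition p q) - 2 := by
    rw [mul_sub, transposition_mul_jm_left ρ hpq, transposition_mul_jm_right ρ hpq, sub_mul,
      ← one_add_one_eq_two]
    abel
  refine (Commute.one_right _).sub_right ?_
  generalize ρ.jm p - ρ.jm q = x at h
  rw [Commute, SemiconjBy, pow_two, ← mul_assoc, h, sub_mul, neg_mul, mul_assoc x, h, mul_sub,
    mul_neg, mul_assoc, mul_two, two_mul]
  abel

/-- The first arc is annihilated by the first factor of `Θ`. -/
theorem arc_mul_thetaFactor_zero {o : Fin n} (ho : (o : ℕ) = 0) (hop : (o : ℕ) + 1 = p)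
    (hpq : (p : ℕ) + 1 = q) : ρ.arc o p * ρ.thetaFactor p q = 0 ∧
      ρ.thetaFactor p q * ρ.arc o p = 0 := by
  have hlt : o < p := Fin.lt_def.2 (by omega)
  have hlt' : p < q := Fin.lt_def.2 (by omega)
  have hI : Finset.Iio o = ∅ := by
    ext l
    simp [Fin.lt_def, ho]
  have hp : ρ.jm p = ρ.jmTerm o p := by
    rw [jm_of_adjacent ρ hop, hI, Finset.sum_empty, add_zero]
  have hq : ρ.jm q = ρ.jmTerm o q + ρ.jmTerm p q := by
    rw [jm_of_adjacent ρ hpq, Iio_of_adjacent hop, hI]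
    simp [add_comm]
  -- The arc kills `jm q`, while `jm p` is the single term `jmTerm o p`. The eigenvalues have signs
  -- opposite to those in `arc_mul_jm_sub`, which does not matter after squaring.
  have h₁ : ρ.arc o p * (ρ.jm p - ρ.jm q) = -ρ.arc o p := by
    rw [mul_sub, hq, ρ.arc_mul_jmTerm_add hlt.ne (hlt.trans hlt').ne hlt'.ne, hp, jmTerm, mul_add,
      arc_mul_transposition, arc_mul_self, add_zero, sub_zero]
  have h₂ : (ρ.jm p - ρ.jm q) * ρ.arc o p = ρ.arc o p := by
    rw [sub_mul, hq, ρ.jmTerm_add_mul_arc hlt.ne (hlt.trans hlt').ne hlt'.ne, hp, jmTerm, add_mul,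
      transposition_mul_arc, arc_mul_self, add_zero, sub_zero]
  constructor
  · rw [thetaFactor, mul_sub, pow_two, ← mul_assoc, h₁, neg_mul, h₁, neg_neg, mul_one, sub_self]
  · rw [thetaFactor, sub_mul, pow_two, mul_assoc, h₂, h₂, one_mul, sub_self]

end Adjacent

end DiagramRep

/-! ### Symmetry of `Θ` as a polynomial -/

/-- Evaluation of polynomials at commuting elements. -/
theorem MvPolynomial.exists_algHom_of_commute {k σ A : Type*} [CommRing k] [Ring A] [Algebra k A]
    (x : σ → A) (hx : ∀ i j, Commute (x i) (x j)) :
    ∃ φ : MvPolynomial σ k →ₐ[k] A, ∀ i, φ (X i) = x i := by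
  have := Algebra.isMulCommutative_adjoin k (s := Set.range x)
    (by rintro _ ⟨i, rfl⟩ _ ⟨j, rfl⟩; exact hx i j)
  let S := Algebra.adjoin k (Set.range x)
  let _ : CommRing S := { mul_comm := mul_comm' }
  exact ⟨S.val.comp (aeval (R := k) (S₁ := S) fun i => ⟨x i, Algebra.subset_adjoin ⟨i, rfl⟩⟩), fun i => by simp⟩

namespace PeriplecticBrauer

open MvPolynomial

variable (k : Type*) [Field k] {n : ℕ}

/-- The factors of `Θ`, as polynomials. -/
noncomputable def thetaFactorPoly (p : Pos n × Pos n) : MvPolynomial (Pos n) k :=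
  1 - (X p.1 - X p.2) ^ 2

theorem thetaFactorPoly_swap (p : Pos n × Pos n) :
    thetaFactorPoly k p.swap = thetaFactorPoly k p := by
  simp only [thetaFactorPoly, Prod.fst_swap, Prod.snd_swap]
  ring

theorem thetaFactorPoly_ne_zero (p : Pos n × Pos n) : thetaFactorPoly k p ≠ 0 := by
  intro h
  simpa [thetaFactorPoly] using congrArg (eval 0) h

theorem rename_thetaFactorPoly (σ : Equiv.Perm (Pos n)) (p : Pos n × Pos n) :
    rename σ (thetaFactorPoly k p) = thetaFactorPoly k (p.map σ σ) := by
  simp [thetaFactorPoly]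

variable (n) in
/-- The pairs that index the factors of `Θ`. -/
def pairs : Finset (Pos n × Pos n) := Finset.univ.filter fun p => p.1 < p.2

variable (n) in
/-- `Θ`, as a polynomial. -/
noncomputable def thetaPoly : MvPolynomial (Pos n) k := ∏ p ∈ pairs n, thetaFactorPoly k p

theorem thetaPoly_isSymmetric : (thetaPoly k n).IsSymmetric := by
  intro σ
  simp only [thetaPoly, map_prod, rename_thetaFactorPoly]
  have key : ∀ (σ : Equiv.Perm (Pos n)) (p : Pos n × Pos n), p ∈ pairs n →
      (if σ p.1 < σ p.2 then (σ p.1, σ p.2) else (σ p.2, σ p.1)) ∈ pairs n := by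
    intro σ p hp
    simp only [pairs, Finset.mem_filter, Finset.mem_univ, true_and] at hp ⊢
    split_ifs with h
    · exact h
    · exact lt_of_le_of_ne (not_lt.1 h) fun h => hp.ne' (σ.injective h)
  have inv : ∀ (σ : Equiv.Perm (Pos n)) (p : Pos n × Pos n), p ∈ pairs n →
      let p' := if σ p.1 < σ p.2 then (σ p.1, σ p.2) else (σ p.2, σ p.1)
      (if σ.symm p'.1 < σ.symm p'.2 then (σ.symm p'.1, σ.symm p'.2)
        else (σ.symm p'.2, σ.symm p'.1)) = p := by
    intro σ p hp
    simp only [pairs, Finset.mem_filter, Finset.mem_univ, true_and] at hp ⊢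
    split_ifs <;> simp_all; order
  -- A permutation acts on unordered pairs, and the factors do not depend on the order within a
  -- pair; each image pair is put back in increasing order.
  refine Finset.prod_nbij'
    (fun p => if σ p.1 < σ p.2 then (σ p.1, σ p.2) else (σ p.2, σ p.1))
    (fun p => if σ.symm p.1 < σ.symm p.2 then (σ.symm p.1, σ.symm p.2)
      else (σ.symm p.2, σ.symm p.1)) (key σ) (key σ.symm) (inv σ) (fun p hp => ?_) fun p _ => ?_
  · simpa using inv σ.symm p hp
  · split_ifs
    · rfl
    · rw [← thetaFactorPoly_swap]; rfl

/-- A symmetric multiple of `Θ` is a multiple of every factor of `Θ` by a polynomial invariant under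
exchanging the two variables of the factor. -/
theorem exists_eq_mul_thetaFactorPoly {f : MvPolynomial (Pos n) k} (hf : f.IsSymmetric)
    {p : Pos n × Pos n} (hp : p ∈ pairs n) :
    ∃ g, f * thetaPoly k n = g * thetaFactorPoly k p ∧ rename (Equiv.swap p.1 p.2) g = g := by
  refine ⟨f * ∏ p' ∈ (pairs n).erase p, thetaFactorPoly k p', ?_, ?_⟩
  · rw [thetaPoly, mul_assoc, Finset.prod_erase_mul _ _ hp]
  · refine mul_right_cancel₀ (thetaFactorPoly_ne_zero k p) ?_
    have h₁ := hf.mul (thetaPoly_isSymmetric k (n := n)) (Equiv.swap p.1 p.2)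
    rw [thetaPoly, ← Finset.prod_erase_mul _ _ hp, ← mul_assoc, map_mul,
      rename_thetaFactorPoly] at h₁
    have h₂ : p.map (Equiv.swap p.1 p.2) (Equiv.swap p.1 p.2) = p.swap := by
      ext <;> simp
    rwa [h₂, thetaFactorPoly_swap] at h₁

end PeriplecticBrauer

/-! ### Centrality of the symmetric multiples of `Θ` -/

namespace DiagramRep

open MvPolynomial PeriplecticBrauer

variable {k : Type*} [Field k] {n : ℕ} {A : Type*} [Ring A] [Algebra k A] (ρ : DiagramRep k n A)

/-- Evaluation of polynomials at the Jucys–Murphy elements. -/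
noncomputable def ev : MvPolynomial (Pos n) k →ₐ[k] A :=
  (exists_algHom_of_commute (k := k) (fun i : Pos n => ρ.jm i.1) fun _ _ => ρ.jm_commute _ _).choose

theorem ev_X (i : Pos n) : ρ.ev (X i) = ρ.jm i.1 :=
  (exists_algHom_of_commute (k := k) (fun i : Pos n => ρ.jm i.1)
    fun _ _ => ρ.jm_commute _ _).choose_spec i

theorem ev_commute (f g : MvPolynomial (Pos n) k) : Commute (ρ.ev f) (ρ.ev g) := by
  rw [Commute, SemiconjBy, ← map_mul, mul_comm, map_mul]

theorem ev_thetaFactorPoly (p : Pos n × Pos n) :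
    ρ.ev (thetaFactorPoly k p) = ρ.thetaFactor p.1.1 p.2.1 := by
  simp [thetaFactorPoly, thetaFactor, ev_X]

/-- `r` is the divided difference of `g`. The factor of `Θ` on the right absorbs every arc produced
by the commutation rules, so only the degenerate affine Hecke relation remains. -/
theorem transposition_mul_ev {p q : Pos n} (hpq : (p.1 : ℕ) + 1 = q.1)
    (g : MvPolynomial (Pos n) k) :
    ∃ r, (X p - X q) * r = g - rename (Equiv.swap p q) g ∧
      ρ.transposition p.1 q.1 * (ρ.ev g * ρ.thetaFactor p.1 q.1) =
        ρ.ev (rename (Equiv.swap p q) g) * (ρ.transposition p.1 q.1 * ρ.thetaFactor p.1 q.1) -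
          ρ.ev r * ρ.thetaFactor p.1 q.1 := by
  have hne : p ≠ q := fun h => by rw [h] at hpq; omega
  have he : ∀ g, ρ.arc p.1 q.1 * (ρ.ev g * ρ.thetaFactor p.1 q.1) = 0 := by
    intro g
    rw [← ev_thetaFactorPoly ρ (p, q), (ρ.ev_commute _ _).eq, ← mul_assoc, ev_thetaFactorPoly,
      arc_mul_thetaFactor ρ hpq, zero_mul]
  have hcomm : ∀ i g x, ρ.ev (X i) * (ρ.ev g * x) = ρ.ev (g * X i) * x := by
    intro i g x
    rw [← mul_assoc, (ρ.ev_commute _ _).eq, map_mul]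
  induction g using MvPolynomial.induction_on with
  | C a =>
    refine ⟨0, by simp, ?_⟩
    have : ρ.ev (C a) = algebraMap k A a := ρ.ev.commutes a
    rw [rename_C, this, map_zero, zero_mul, sub_zero, ← mul_assoc, ← Algebra.commutes, mul_assoc]
  | add g g' h h' =>
    obtain ⟨r, hr, h⟩ := h
    obtain ⟨r', hr', h'⟩ := h'
    refine ⟨r + r', ?_, ?_⟩
    · rw [mul_add, hr, hr', map_add]; ring
    · simp only [map_add, add_mul, mul_add, h, h']
      abel
  | mul_X g i h =>
    obtain ⟨r, hr, h⟩ := h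
    have hg : ρ.ev (g * X i) * ρ.thetaFactor p.1 q.1 =
        ρ.jm i.1 * (ρ.ev g * ρ.thetaFactor p.1 q.1) := by
      rw [← ev_X, hcomm]
    rw [hg, ← mul_assoc, map_mul, rename_X]
    rcases eq_or_ne i p with rfl | hp
    · refine ⟨r * X q + g, ?_, ?_⟩
      · rw [Equiv.swap_apply_left]
        linear_combination X q * hr
      · rw [transposition_mul_jm_left ρ hpq, add_mul, sub_mul, one_mul, he, mul_assoc, h,
          Equiv.swap_apply_left, ← ev_X, mul_sub, hcomm, hcomm, map_add, add_mul]
        abel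
    rcases eq_or_ne i q with rfl | hq
    · refine ⟨r * X p - g, ?_, ?_⟩
      · rw [Equiv.swap_apply_right]
        linear_combination X p * hr
      · rw [transposition_mul_jm_right ρ hpq, add_mul, add_mul, one_mul, he, mul_assoc, h,
          Equiv.swap_apply_right, ← ev_X, mul_sub, hcomm, hcomm, map_sub, sub_mul]
        abel
    · refine ⟨r * X i, ?_, ?_⟩
      · rw [Equiv.swap_apply_of_ne_of_ne hp hq]
        linear_combination X i * hr
      · have hp' : (i.1 : ℕ) ≠ p.1 := fun h => hp (Subtype.ext (Fin.ext h))
        have hq' : (i.1 : ℕ) ≠ q.1 := fun h => hq (Subtype.ext (Fin.ext h))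
        have : Commute (ρ.transposition p.1 q.1) (ρ.jm i.1) := by
          refine ρ.perm_commute_jm (Equiv.swap_apply_of_ne_of_ne (fun h => hp' (congrArg _ h))
            fun h => hq' (congrArg _ h)) fun l => ?_
          rw [Equiv.swap_apply_def]
          split_ifs with h h' <;> simp only [Fin.lt_def, Fin.ext_iff] at * <;> omega
        rw [this.eq, mul_assoc, h, Equiv.swap_apply_of_ne_of_ne hp hq, ← ev_X, mul_sub, hcomm,
          hcomm]

/-- For invariant `g` the divided difference vanishes, polynomials over a field having no zero
divisors. -/
theorem transposition_commute_ev {p q : Pos n} (hpq : (p.1 : ℕ) + 1 = q.1)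
    {g : MvPolynomial (Pos n) k} (hg : rename (Equiv.swap p q) g = g) :
    Commute (ρ.transposition p.1 q.1) (ρ.ev (g * thetaFactorPoly k (p, q))) := by
  have hne : p ≠ q := fun h => by rw [h] at hpq; omega
  obtain ⟨r, hr, h⟩ := ρ.transposition_mul_ev hpq g
  have hr0 : r = 0 := by
    rw [hg, sub_self] at hr
    refine (mul_eq_zero.1 hr).resolve_left fun h => ?_
    exact hne (X_injective (sub_eq_zero.1 h))
  rw [hg, hr0, map_zero, zero_mul, sub_zero, (transposition_commute_thetaFactor ρ hpq).eq,
    ← mul_assoc _ (ρ.thetaFactor _ _)] at h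
  rw [map_mul, ev_thetaFactorPoly]
  exact h

/-- The elements `f Θ` commute with the adjacent transpositions and are annihilated by the adjacent
arcs. -/
theorem adjacent_ev_mul_thetaPoly (hn : 2 < n) {f : MvPolynomial (Pos n) k} (hf : f.IsSymmetric)
    {a b : Fin n} (hab : (a : ℕ) + 1 = b) :
    Commute (ρ.transposition a b) (ρ.ev (f * thetaPoly k n)) ∧
      ρ.arc a b * ρ.ev (f * thetaPoly k n) = 0 ∧ ρ.ev (f * thetaPoly k n) * ρ.arc a b = 0 := by
  rcases Nat.eq_zero_or_pos (a : ℕ) with ha | ha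
  · set p : Pos n := ⟨b, by omega⟩ with hp
    -- No factor of `Θ` involves the first dot; the factor of positions 1 and 2 (counted from 0) is
    -- used instead, and it exists because `2 < n`.
    set q : Pos n := ⟨⟨2, hn⟩, by simp⟩ with hq
    have hpq : (p.1 : ℕ) + 1 = q.1 := by simp only [hp, hq]; omega
    have hmem : (p, q) ∈ pairs n := by
      simp only [pairs, Finset.mem_filter, Finset.mem_univ, true_and, ← Subtype.coe_lt_coe,
        Fin.lt_def]
      omega
    obtain ⟨g, hg, -⟩ := exists_eq_mul_thetaFactorPoly k hf hmem
    obtain ⟨h₁, h₂⟩ := arc_mul_thetaFactor_zero ρ ha hab hpq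
    have h₃ : ρ.arc a b * ρ.ev (f * thetaPoly k n) = 0 := by
      rw [hg, mul_comm, map_mul, ev_thetaFactorPoly, ← mul_assoc, h₁, zero_mul]
    have h₄ : ρ.ev (f * thetaPoly k n) * ρ.arc a b = 0 := by
      rw [hg, map_mul, ev_thetaFactorPoly, mul_assoc, h₂, mul_zero]
    refine ⟨?_, h₃, h₄⟩
    -- The transposition is `jm b` minus the arc: the former commutes with all polynomials, the
    -- latter annihilates on both sides.
    have hjm : ρ.transposition a b = ρ.ev (X p) - ρ.arc a b := by
      have hI : Finset.Iio a = ∅ := by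
        ext l
        simp [Fin.lt_def, ha]
      rw [ev_X, jm_of_adjacent ρ hab, hI, Finset.sum_empty, add_zero, jmTerm, add_sub_cancel_right]
    rw [hjm]
    exact (ρ.ev_commute _ _).sub_left (h₃.trans h₄.symm)
  · set p : Pos n := ⟨a, ha⟩ with hp
    set q : Pos n := ⟨b, by omega⟩ with hq
    have hmem : (p, q) ∈ pairs n := by
      simp only [pairs, Finset.mem_filter, Finset.mem_univ, true_and, ← Subtype.coe_lt_coe,
        Fin.lt_def, hp, hq]
      omega
    obtain ⟨g, hg, hg'⟩ := exists_eq_mul_thetaFactorPoly k hf hmem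
    refine ⟨hg ▸ ρ.transposition_commute_ev (p := p) (q := q) hab hg', ?_, ?_⟩
    · rw [hg, mul_comm, map_mul, ev_thetaFactorPoly, ← mul_assoc, arc_mul_thetaFactor ρ hab,
        zero_mul]
    · rw [hg, map_mul, ev_thetaFactorPoly, mul_assoc, thetaFactor_mul_arc ρ hab, mul_zero]

theorem perm_commute_of_adjacent {F : A} (hF : ∀ {a b : Fin n}, (a : ℕ) + 1 = b →
    Commute (ρ.transposition a b) F) (w : Equiv.Perm (Fin n)) : Commute (ρ.perm w) F := by
  rcases n with _ | n
  · rw [Subsingleton.elim w 1, map_one]; exact Commute.one_left _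
  have hw : w ∈ Submonoid.closure
      (Set.range fun i : Fin n => Equiv.swap i.castSucc i.succ) := by
    rw [Equiv.Perm.mclosure_swap_castSucc_succ]; trivial
  induction hw using Submonoid.closure_induction with
  | mem x hx =>
    obtain ⟨i, rfl⟩ := hx
    exact hF (by simp)
  | one => rw [map_one]; exact Commute.one_left _
  | mul x y _ _ hx hy => rw [map_mul]; exact hx.mul_left hy

theorem arc_apply (w : Equiv.Perm (Fin n)) (a b : Fin n) :
    ρ.arc (w a) (w b) = ρ.perm w * ρ.arc a b * ρ.perm w⁻¹ := by
  rw [perm_mul_arc, mul_assoc, ← map_mul, mul_inv_cancel, map_one, mul_one]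

theorem arc_mul_eq_zero_of_perm_commute {F : A} (hF : ∀ w, Commute (ρ.perm w) F) {a b : Fin n}
    (hab : a ≠ b) (h : ρ.arc a b * F = 0 ∧ F * ρ.arc a b = 0) (c d : Fin n) :
    ρ.arc c d * F = 0 ∧ F * ρ.arc c d = 0 := by
  rcases eq_or_ne c d with rfl | hcd
  · simp [arc]
  have key : ∀ w : Equiv.Perm (Fin n),
      ρ.arc (w a) (w b) * F = 0 ∧ F * ρ.arc (w a) (w b) = 0 := by
    intro w
    rw [arc_apply, mul_assoc, (hF w⁻¹).eq, ← mul_assoc, mul_assoc (ρ.perm w), h.1, ← mul_assoc,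
      ← mul_assoc, ← (hF w).eq, mul_assoc (ρ.perm w) F, h.2]
    simp
  -- The inner transposition fixes `a`, so the product of the two transpositions below takes `a` to
  -- `c` and `b` to `d`.
  have hc : a ≠ Equiv.swap a c d := by
    rw [Equiv.swap_apply_def]; grind
  have := key (Equiv.swap a c * Equiv.swap b (Equiv.swap a c d))
  rwa [Equiv.Perm.mul_apply, Equiv.Perm.mul_apply, Equiv.swap_apply_of_ne_of_ne hab hc,
    Equiv.swap_apply_left, Equiv.swap_apply_left, Equiv.swap_apply_self] at this

/-- An element that commutes with the permutations and is annihilated by the arcs commutes with all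
diagrams and is annihilated by the diagrams with a cap. -/
theorem toFun_commute {F : A} (hF : ∀ w, Commute (ρ.perm w) F)
    (h₁ : ∀ a b, ρ.arc a b * F = 0) (h₂ : ∀ a b, F * ρ.arc a b = 0) (d : BrauerDiagram n) :
    Commute (ρ.toFun d) F ∧ (d.HasCap → ρ.toFun d * F = 0 ∧ F * ρ.toFun d = 0) := by
  induction hl : d.standardMarking.length using Nat.strong_induction_on generalizing d with
  | _ l ih =>
    by_cases hd : d.HasCap
    · suffices H : ρ.toFun d * F = 0 ∧ F * ρ.toFun d = 0 from
        ⟨H.1.trans H.2.symm, fun _ => H⟩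
      obtain ⟨d', a, b, p, q, hab, ha, hb, rfl⟩ := hd.exists_eq_bend
      have hd' := (ih d'.standardMarking.length
        (by rw [← hl, BrauerDiagram.length_standardMarking_bend hab]; omega) d' rfl).1
      obtain ⟨γ, h⟩ := BrauerDiagram.exists_composes_bend hab ha hb
      have h₃ : ρ.toFun (d'.bend hab.ne ha hb) =
          (-1 : k) ^ γ • (ρ.toFun d' * ρ.arc a b) := by
        rw [ρ.arc_of_lt hab, ρ.mul_of_composes h, smul_smul, ← mul_pow]
        simp
      rw [h₃, smul_mul_assoc, mul_smul_comm, mul_assoc, h₁, ← mul_assoc F, ← hd'.eq, mul_assoc, h₂]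
      simp
    · obtain ⟨w, rfl⟩ := BrauerDiagram.exists_eq_ofPerm hd
      exact ⟨hF w, fun h => absurd h hd⟩

theorem toFun_commute_ev_mul_thetaPoly (hn : 2 < n) {f : MvPolynomial (Pos n) k}
    (hf : f.IsSymmetric) (d : BrauerDiagram n) :
    Commute (ρ.toFun d) (ρ.ev (f * thetaPoly k n)) ∧ (d.HasCap →
      ρ.toFun d * ρ.ev (f * thetaPoly k n) = 0 ∧ ρ.ev (f * thetaPoly k n) * ρ.toFun d = 0) := by
  have hF := ρ.perm_commute_of_adjacent (F := ρ.ev (f * thetaPoly k n))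
    fun h => (ρ.adjacent_ev_mul_thetaPoly hn hf h).1
  have h₀ := ρ.adjacent_ev_mul_thetaPoly hn hf (a := ⟨0, by omega⟩) (b := ⟨1, by omega⟩) rfl
  have hne : (⟨0, by omega⟩ : Fin n) ≠ ⟨1, by omega⟩ := by simp
  have h := ρ.arc_mul_eq_zero_of_perm_commute hF hne h₀.2
  exact ρ.toFun_commute hF (fun a b => (h a b).1) (fun a b => (h a b).2) d

end DiagramRep

/-- The subalgebra `k1 + M` for a subspace `M` that is closed under multiplication. -/
def Submodule.spanOneSup {k A : Type*} [CommSemiring k] [Semiring A] [Algebra k A]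
    (M : Submodule k A) (hM : M * M ≤ M) : Subalgebra k A :=
  Submodule.toSubalgebra (Submodule.span k {(1 : A)} ⊔ M)
    (Submodule.mem_sup_left (Submodule.mem_span_singleton_self 1)) <| by
    intro x y hx hy
    have h := Submodule.mul_mem_mul hx hy
    rw [← Submodule.one_eq_span, Submodule.sup_mul, Submodule.mul_sup, one_mul,
      one_mul] at h
    rw [← Submodule.one_eq_span]
    have h' : 1 ⊔ M ⊔ (M * (1 ⊔ M)) ≤ 1 ⊔ M := by
      rw [Submodule.mul_sup, mul_one]
      exact sup_le le_rfl (sup_le le_sup_right (hM.trans le_sup_right))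
    exact h' h

/-! ### Transfer to the periplectic Brauer algebra -/

namespace PeriplecticBrauer

open BrauerDiagram MvPolynomial

variable (k : Type*) [Field k]

/-- The diagrams as elements of the periplectic Brauer algebra. -/
noncomputable def diagramRep (n : ℕ) : DiagramRep k n (PeriplecticBrauer k n) where
  toFun := ofDiagram k
  toFun_one := by
    simpa [ofDiagram] using RingQuot.mkAlgHom_rel k (Rel.one (k := k) (n := n))
  mul_of_hasLoop {d₁ d₂} h := by
    simpa [ofDiagram] using RingQuot.mkAlgHom_rel k (Rel.loop (k := k) d₁ d₂ h)
  mul_of_composes {d₁ d₂ d γ} h := by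
    simpa [ofDiagram] using RingQuot.mkAlgHom_rel k (Rel.comp (k := k) d₁ d₂ d γ h)

variable {n : ℕ}

theorem jm_eq (i : Fin n) : jm k i = (diagramRep k n).jm i := by
  have h : ∀ j : {j : Fin n // j < i},
      ofDiagram k (ofPerm (Equiv.swap j.1 i)) + ofDiagram k (bar j.1 i j.2.ne) =
        (diagramRep k n).jmTerm j.1 i := by
    intro j
    rw [DiagramRep.jmTerm, DiagramRep.arc_of_lt _ j.2]
    rfl
  rw [jm, DiagramRep.jm, Finset.sum_congr rfl fun j _ => h j]
  exact (Finset.sum_subtype (Finset.Iio i) (fun x => Finset.mem_Iio)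
    (fun j => (diagramRep k n).jmTerm j i)).symm

theorem jm_eq_ev (i : Pos n) : jm k i.1 = (diagramRep k n).ev (X i) := by
  rw [jm_eq, DiagramRep.ev_X]

theorem evalJM_eq (f : MvPolynomial (Pos n) k) : evalJM k f = (diagramRep k n).ev f := by
  conv_rhs => rw [f.as_sum, map_sum]
  refine Finset.sum_congr rfl fun m _ => ?_
  have h : monomial m (f.coeff m) =
      f.coeff m • (((Finset.univ : Finset (Pos n)).sort (· ≤ ·)).map fun i => X i ^ m i).prod := by
    rw [← List.prod_toFinset _ (Finset.sort_nodup _ _), Finset.sort_toFinset, smul_eq_C_mul,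
      monomial_eq, Finsupp.prod_fintype _ _ (by simp)]
  rw [h, map_smul, map_list_prod, List.map_map]
  refine congrArg _ (congrArg _ (List.map_congr_left fun i _ => ?_))
  rw [Function.comp_apply, map_pow, jm_eq_ev]

theorem theta_eq (hn : n ≠ 2) : theta k n = (diagramRep k n).ev (thetaPoly k n) := by
  have h : thetaPoly k n = ((((Finset.univ : Finset (Pos n)).sort (· ≤ ·) ×ˢ
        (Finset.univ : Finset (Pos n)).sort (· ≤ ·)).filter fun p => p.1 < p.2).map
      (thetaFactorPoly k)).prod := by
    rw [← List.prod_toFinset _ (((Finset.sort_nodup _ _).product (Finset.sort_nodup _ _)).filter _),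
      thetaPoly]
    congr 1
    ext p
    obtain ⟨p, q⟩ := p
    simp [pairs]
  rw [theta, if_neg hn, h, map_list_prod, List.map_map]
  refine congrArg _ (List.map_congr_left fun p _ => ?_)
  rw [Function.comp_apply, DiagramRep.ev_thetaFactorPoly, jm_eq, jm_eq]
  rfl

/-! ### The trivial character and the direct sum -/

open Classical in
/-- The character of the periplectic Brauer algebra that is trivial on permutations and vanishes on
diagrams with caps. -/
noncomputable def character (n : ℕ) : PeriplecticBrauer k n →ₐ[k] k :=
  RingQuot.liftAlgHom k ⟨FreeAlgebra.lift k fun d => if d.HasCap then 0 else 1, by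
    intro x y h
    induction h with
    | one => simp [not_hasCap_ofPerm]
    | loop d₁ d₂ h =>
      have : d₁.HasCap ∨ d₂.HasCap := by
        by_contra hd
        rw [not_or] at hd
        obtain ⟨u, rfl⟩ := exists_eq_ofPerm hd.1
        obtain ⟨w, rfl⟩ := exists_eq_ofPerm hd.2
        exact (composes_ofPerm u w).1 h
      rcases this with h | h <;> simp [h]
    | comp d₁ d₂ d γ h =>
      by_cases h₂ : d₂.HasCap
      · have : d.HasCap := by
          obtain ⟨i, j, hij⟩ := h₂
          refine ⟨i, j, (h.2.1 _ _).2 ⟨fun h => d₂.partner_ne _ (hij.trans h.symm), ?_⟩⟩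
          exact connected_lower _ _ hij
        simp [this, h₂]
      obtain ⟨w, rfl⟩ := exists_eq_ofPerm h₂
      by_cases h₁ : d₁.HasCap
      · have : d.HasCap := by
          obtain ⟨i, j, hij⟩ := h₁
          have hw : ∀ i, Connected d₁ (ofPerm w) (.bot (w.symm i)) (.mid i) := fun i =>
            connected_lower d₁ (ofPerm w) (x := .inl (w.symm i)) (y := .inr i) (by simp [ofPerm])
          refine ⟨w.symm i, w.symm j, (h.2.1 _ _).2 ⟨fun h => d₁.partner_ne (.inl i) ?_, ?_⟩⟩
          · rw [hij, Sum.inl_injective.eq_iff, ← w.symm.injective.eq_iff]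
            exact (Sum.inl_injective h).symm
          · exact ((hw i).trans (connected_upper _ _ hij)).trans (hw j).symm
        simp [this, h₁]
      obtain ⟨u, rfl⟩ := exists_eq_ofPerm h₁
      -- For two permutations nothing is marked, so `γ = 0`; for other products all terms vanish and
      -- the sign is irrelevant.
      rw [h.2.1.unique (composes_ofPerm u w).2.1,
        (h.2.2.eq_zero_of_nil (stackMarking_ofPerm u w)).1]
      simp [not_hasCap_ofPerm]⟩

open Classical in
theorem character_ofDiagram (d : BrauerDiagram n) :
    character k n (ofDiagram k d) = if d.HasCap then 0 else 1 := by
  simp [character, ofDiagram]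

theorem character_jm (i : Fin n) : character k n (jm k i) = (i : ℕ) := by
  have h : ∀ (j : Fin n) (h : j ≠ i), (bar j i h).HasCap := fun j h => ⟨i, j, by simp [bar]⟩
  have hi : Fintype.card {j // j < i} = i := by
    rw [Fintype.card_of_subtype (Finset.Iio i) fun x => Finset.mem_Iio, Fin.card_Iio]
  simp [jm, character_ofDiagram, not_hasCap_ofPerm, h, hi]

/-- The values of the character at `x_2` and `x_3` differ by 1, so the factor `1 - (x_2 - x_3)²` is
sent to zero. -/
theorem character_theta (hn : 2 ≤ n) : character k n (theta k n) = 0 := by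
  rcases eq_or_ne n 2 with rfl | hn'
  · simp [theta]
  · set p : Pos n := ⟨⟨1, by omega⟩, by simp⟩
    set q : Pos n := ⟨⟨2, by omega⟩, by simp⟩
    have hmem : (p, q) ∈ pairs n := by simp [pairs, p, q]
    let ψ := (character k n).comp (diagramRep k n).ev
    have hψ : ∀ i, ψ (X i) = ((i.1 : ℕ) : k) := fun i => by
      rw [AlgHom.comp_apply, ← jm_eq_ev, character_jm]
    have : ψ (thetaFactorPoly k (p, q)) = 0 := by
      simp only [thetaFactorPoly, map_sub, map_pow, map_one, hψ, p, q]
      norm_num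
    rw [theta_eq k hn', ← AlgHom.comp_apply, thetaPoly, ← Finset.prod_erase_mul _ _ hmem]
    exact (map_mul ψ _ _).trans (by rw [this, mul_zero])

theorem mem_center_of_commute {F : PeriplecticBrauer k n}
    (h : ∀ d, Commute (ofDiagram k d) F) : F ∈ Subalgebra.center k (PeriplecticBrauer k n) := by
  rw [Subalgebra.mem_center_iff]
  intro b
  obtain ⟨b, rfl⟩ := RingQuot.mkAlgHom_surjective k (Rel k n) b
  induction b using FreeAlgebra.induction with
  | grade0 r => rw [AlgHom.commutes]; exact Algebra.commutes _ _
  | grade1 d => exact h d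
  | mul a b ha hb => rw [map_mul]; exact Commute.mul_left ha hb
  | add a b ha hb => rw [map_add]; exact Commute.add_left ha hb

theorem evalJM_mul_theta (hn : n ≠ 2) (f : MvPolynomial (Pos n) k) :
    evalJM k f * theta k n = (diagramRep k n).ev (f * thetaPoly k n) := by
  rw [map_mul, evalJM_eq, theta_eq k hn]

theorem theta_mul_evalJM (f : MvPolynomial (Pos n) k) :
    theta k n * evalJM k f = evalJM k f * theta k n := by
  rcases eq_or_ne n 2 with rfl | hn
  · simp [theta]
  · rw [theta_eq k hn, evalJM_eq]
    exact (diagramRep k n).ev_commute _ _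

theorem ofDiagram_commute_evalJM_mul_theta (hn : 2 ≤ n) {f : MvPolynomial (Pos n) k}
    (hf : f.IsSymmetric) (d : BrauerDiagram n) :
    Commute (ofDiagram k d) (evalJM k f * theta k n) ∧ (d.HasCap →
      ofDiagram k d * (evalJM k f * theta k n) = 0 ∧
        (evalJM k f * theta k n) * ofDiagram k d = 0) := by
  rcases eq_or_ne n 2 with rfl | hn'
  · simp [theta]
  · rw [evalJM_mul_theta k hn']
    exact (diagramRep k n).toFun_commute_ev_mul_thetaPoly (lt_of_le_of_ne hn hn'.symm) hf d

theorem capIdeal_mul_evalJM_mul_theta (hn : 2 ≤ n) {f : MvPolynomial (Pos n) k}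
    (hf : f.IsSymmetric) {a : PeriplecticBrauer k n} (ha : a ∈ capIdeal k n) :
    a * (evalJM k f * theta k n) = 0 ∧ (evalJM k f * theta k n) * a = 0 := by
  induction ha using Submodule.span_induction with
  | mem x hx =>
    obtain ⟨d, hd, rfl⟩ := hx
    exact (ofDiagram_commute_evalJM_mul_theta k hn hf d).2 (hd.elim hasCap_of_hasCup id)
  | zero => exact ⟨zero_mul _, mul_zero _⟩
  | add x y _ _ hx hy =>
    exact ⟨by rw [add_mul, hx.1, hy.1, add_zero], by rw [mul_add, hx.2, hy.2, add_zero]⟩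
  | smul c x _ hx =>
    exact ⟨by rw [smul_mul_assoc, hx.1, smul_zero], by rw [mul_smul_comm, hx.2, smul_zero]⟩

theorem thetaSymm_le_center (hn : 2 ≤ n) :
    thetaSymm k n ≤ Subalgebra.toSubmodule (Subalgebra.center k (PeriplecticBrauer k n)) := by
  refine Submodule.span_le.2 ?_
  rintro _ ⟨f, hf, rfl⟩
  rw [theta_mul_evalJM]
  exact mem_center_of_commute k fun d => (ofDiagram_commute_evalJM_mul_theta k hn hf d).1

theorem thetaSymm_mul_thetaSymm_le : thetaSymm k n * thetaSymm k n ≤ thetaSymm k n := by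
  rcases eq_or_ne n 2 with rfl | hn
  · have : thetaSymm k 2 = ⊥ := by
      refine Submodule.span_eq_bot.2 ?_
      rintro _ ⟨f, -, rfl⟩
      simp [theta]
    rw [this, Submodule.bot_mul]
  · rw [thetaSymm, Submodule.span_mul_span]
    refine Submodule.span_mono ?_
    rintro _ ⟨_, ⟨f, hf, rfl⟩, _, ⟨g, hg, rfl⟩, rfl⟩
    -- `Θ f · Θ g = Θ (f Θ g)`, and `f Θ g` is again symmetric.
    refine ⟨f * thetaPoly k n * g, (hf.mul (thetaPoly_isSymmetric k)).mul hg, ?_⟩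
    simp only [evalJM_eq, theta_eq k hn, ← map_mul]
    exact congrArg (diagramRep k n).ev (by ring)

theorem disjoint_span_one_thetaSymm (hn : 2 ≤ n) :
    Disjoint (Submodule.span k {(1 : PeriplecticBrauer k n)}) (thetaSymm k n) := by
  have h : thetaSymm k n ≤ LinearMap.ker (character k n).toLinearMap := by
    refine Submodule.span_le.2 ?_
    rintro _ ⟨f, -, rfl⟩
    simp [character_theta k hn]
  rw [Submodule.disjoint_def]
  intro x hx hx'
  obtain ⟨c, rfl⟩ := Submodule.mem_span_singleton.1 hx
  have := h hx'
  simp only [LinearMap.mem_ker, AlgHom.toLinearMap_apply, map_smul, map_one, smul_eq_mul,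
    mul_one] at this
  rw [this, zero_smul]

/-- The subalgebra `k1 ⊕ Θ k[x_2, …, x_n]^{S_{n-1}}`. -/
noncomputable def thetaSubalgebra (n : ℕ) : Subalgebra k (PeriplecticBrauer k n) :=
  Submodule.spanOneSup (thetaSymm k n) (thetaSymm_mul_thetaSymm_le k)

end PeriplecticBrauer

open PeriplecticBrauer BrauerDiagram in
theorem mainTheorem9 (k : Type*) [Field k] (n : ℕ) (hn : 2 ≤ n) :
    (∀ i j : Fin n, Commute (jm k i) (jm k j)) ∧
    (∀ f : MvPolynomial (Pos n) k, f.IsSymmetric →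
      (∀ w : Equiv.Perm (Fin n),
        ofDiagram k (ofPerm w) * (evalJM k f * theta k n) =
          (evalJM k f * theta k n) * ofDiagram k (ofPerm w)) ∧
      (∀ a ∈ capIdeal k n,
        a * (evalJM k f * theta k n) = 0 ∧ (evalJM k f * theta k n) * a = 0) ∧
      evalJM k f * theta k n ∈ Subalgebra.center k (PeriplecticBrauer k n)) ∧
    Disjoint (Submodule.span k {(1 : PeriplecticBrauer k n)}) (thetaSymm k n) ∧
    ∃ S : Subalgebra k (PeriplecticBrauer k n),
      Subalgebra.toSubmodule S =
          Submodule.span k {(1 : PeriplecticBrauer k n)} ⊔ thetaSymm k n ∧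
      S ≤ Subalgebra.center k (PeriplecticBrauer k n) := by
  refine ⟨fun i j => ?_, fun f hf => ⟨fun w => ?_, fun a ha => ?_, ?_⟩,
    disjoint_span_one_thetaSymm k hn, thetaSubalgebra k n, rfl, ?_⟩
  · rw [jm_eq, jm_eq]
    exact (diagramRep k n).jm_commute i j
  · exact (ofDiagram_commute_evalJM_mul_theta k hn hf _).1
  · exact capIdeal_mul_evalJM_mul_theta k hn hf ha
  · exact mem_center_of_commute k fun d => (ofDiagram_commute_evalJM_mul_theta k hn hf d).1
  · have h : Submodule.span k {(1 : PeriplecticBrauer k n)} ≤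
        Subalgebra.toSubmodule (Subalgebra.center k (PeriplecticBrauer k n)) := by
      rw [Submodule.span_singleton_le_iff_mem]
      exact one_mem (Subalgebra.center k (PeriplecticBrauer k n))
    exact sup_le h (thetaSymm_le_center k hn)
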